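/- **Setting.** Let $\mathbb F_q$ be a finite field and $n$ a positive integer with $\gcd(4n,q)=1$. Let $Q_{4n}=\langle x,y : x^{2n}=1,\ y^2=x^n,\ yxy^{-1}=x^{-1}\rangle$. Put $\delta(n)=1$, $\mu(n)=1$ for $n$ odd and $\delta(n)=2$, $\mu(n)=0$ for $n$ even. For a polynomial $g$ with $g(0)\ne0$ let $g^*(x)=g(0)^{-1}x^{\deg g}g(x^{-1})$. Write $$x^n-1=\prod_{j=1}^{r}f_j\prod_{j=r+1}^{r+s}f_jf_j^*,\qquad x^n+1=\prod_{i=1}^{t}g_i\prod_{i=t+1}^{t+k}g_ig_i^*$$ with all $f_j,g_i\in\mathbb F_q[x]$ monic irreducible, $f_j=f_j^*$ for $j\le r$, $g_i=g_i^*$ for $i\le t$, $f_1=x-1$, $f_2=x+1$ if $n$ is even, and $g_1=x+1$ if $n$ is odd. Let $\alpha_j$ be a root of $f_j$ and $\beta_i$ a root of $g_i$ (in some extension field). For a monic divisor $g$ of $x^{2n}-1$ of degree $d\ge1$ let $$e_g(x)=-\frac{[(\hat g)']^{\wedge}}{2n}\cdot\frac{x^{2n}-1}{g(x)},\qquad \hat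 g=x^{d}g(x^{-1}),\quad \hat h=x^{d-1}h(x^{-1})\ \text{for } h=(\hat g)',$$ viewed in $\mathbb F_q[Q_{4n}]$; modulo $x^{2n}-1$ it is the generating idempotent of the ideal $\big(\tfrac{x^{2n}-1}{g}\big)$ of $\mathbb F_q[x]/(x^{2n}-1)$. Define $\mathbb F_q$-algebra homomorphisms $\tau_j$ ($1\le j\le r+s$) from $\mathbb F_q[Q_{4n}]$ to $A_j$, and $\eta_i$ ($1\le i\le t+k$) from $\mathbb F_q[Q_{4n}]$ to $B_i$, as follows. * $j\le\delta(n)$: $A_j=\mathbb F_q\oplus\mathbb F_q$, $x\mapsto(\varepsilon,\varepsilon)$ with $\varepsilon$ the root of $f_j$, $y\mapsto(1,-1)$. * $\delta(n)<j\le r$: $A_j=\mathrm{Mat}_2(F_j)$, $F_j=\mathbb F_q[\sigma]$ with $\sigma=\alpha_j+\alpha_j^{-1}$, $x\mapsto\begin{pmatrix}0&1\\-1&\sigma\end{pmatrix}$, $y\mapsto\begin{pmatrix}1&-\sigma\\0&-1\end{pmatrix}$. * $r<j\le r+s$: $A_j=\mathrm{Mat}_2(F_j)$, $F_j=\mathbb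 F_q[\alpha_j]$, $x\mapsto\mathrm{diag}(\alpha_j,\alpha_j^{-1})$, $y\mapsto\begin{pmatrix}0&1\\1&0\end{pmatrix}$. * $i\le\mu(n)$, $q\equiv1\pmod 4$: $B_i=\mathbb F_q\oplus\mathbb F_q$, $x\mapsto(-1,-1)$, $y\mapsto(\sqrt{-1},-\sqrt{-1})$, for a fixed square root $\sqrt{-1}\in\mathbb F_q$. * $i\le\mu(n)$, $q\equiv3\pmod 4$: $B_i=\mathbb F_q[\sqrt{-1}]=\mathbb F_q[T]/(T^2+1)$, $x\mapsto-1$, $y\mapsto\sqrt{-1}$. * $\mu(n)<i\le t$: $B_i=\mathrm{Mat}_2(L_i)$, $L_i=\mathbb F_q[\sigma]$ with $\sigma=\beta_i+\beta_i^{-1}$, $x\mapsto\begin{pmatrix}0&1\\-1&\sigma\end{pmatrix}$, $y\mapsto\begin{pmatrix}c&d\\d+c\sigma&-c\end{pmatrix}$, for any fixed $c,d\in L_i$ with $c^2+\sigma cd+d^2=-1$. * $t<i\le t+k$: $B_i=\mathrm{Mat}_2(L_i)$, $L_i=\mathbb F_q[\beta_i]$, $x\mapsto\mathrm{diag}(\beta_i,\beta_i^{-1})$,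 $y\mapsto\begin{pmatrix}0&1\\-1&0\end{pmatrix}$. Let $\rho=((\tau_j)_j,(\eta_i)_i):\mathbb F_q[Q_{4n}]\to\bigoplus_jA_j\oplus\bigoplus_iB_i$. For $j\le\delta(n)$ let $I_j(a,b)=\{(ca,db):c,d\in\mathbb F_q\}$, and for $j>\delta(n)$ let $I_j(a,b)=\left\{\begin{pmatrix}cb&-ca\\db&-da\end{pmatrix}:c,d\in F_j\right\}$; define $J_i(a,b)$ likewise, with $L_i$ for $i>\mu(n)$ (it is not used for $i\le\mu(n)$, $q\equiv 3\pmod 4$). **Theorem.** Let $\lambda\in\mathbb F_q[Q_{4n}]$ be an idempotent, $C=\mathbb F_q[Q_{4n}]\lambda$, $C_j=\tau_j(C)$, $C'_i=\eta_i(C)$, and $$\phi_j=\lambda e_{f_j}(x),\quad\tilde\phi_j=\lambda e_{f_j^*}(x)\ (j>r),\quad\psi_i=\lambda e_{g_i}(x),\quad\tilde\psi_i=\lambda e_{g_i^*}(x)\ (i>t).$$ Then $\rho$ is an isomorphism and $\rho(C)=\bigoplus_jC_j\oplus\bigoplus_iC'_i$. The blocks are determined by these products: $C_j=A_j\tau_j(\phi_j)$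 for $j\le r$, $C_j=A_j\tau_j(\phi_j+\tilde\phi_j)$ for $j>r$, $C'_i=B_i\eta_i(\psi_i)$ for $i\le t$, and $C'_i=B_i\eta_i(\psi_i+\tilde\psi_i)$ for $i>t$. Explicitly: 1. For $1\le j\le\delta(n)$, one of the following cases occurs: $\phi_j=\frac{1+y}2e_{f_j}(x)$ and $C_j=I_j(1,0)$; $\phi_j=\frac{1-y}2e_{f_j}(x)$ and $C_j=I_j(0,1)$; $\phi_j=0$ and $C_j=0$; $\phi_j=e_{f_j}(x)$ and $C_j=A_j$. 2. For $\delta(n)<j\le r$: $C_j=0$ if $\phi_j=0$; $C_j=A_j$ if $\phi_j=e_{f_j}(x)$; otherwise $C_j=I_j(a,b)$ for some $(a,b)\ne(0,0)$ in $F_j^2$. 3. For $r<j\le r+s$ and any $u_j,v_j,\tilde u_j,\tilde v_j\in\mathbb F_q[x]$ with $\phi_j=u_j(x)+yv_j(x)$ and $\tilde\phi_j=\tilde u_j(x)+y\tilde v_j(x)$: * $C_j=A_j$ if $v_j(x)=\tilde v_j(x)=0$, $u_j(x)=e_{f_j}(x)$ and $\tilde u_j(x)=e_{f_j^*}(x)$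 in $\mathbb F_q[Q_{4n}]$; * otherwise $C_j=I_j(\tilde v_j(\alpha_j^{-1}),-u_j(\alpha_j))$ if $(\tilde v_j(\alpha_j^{-1}),u_j(\alpha_j))\ne(0,0)$; * otherwise $C_j=I_j(\tilde u_j(\alpha_j^{-1}),-v_j(\alpha_j))$ if $(\tilde u_j(\alpha_j^{-1}),v_j(\alpha_j))\ne(0,0)$; * $C_j=0$ if all four of these values are $0$. 4. For $1\le i\le\mu(n)$ and $q\equiv1\pmod4$, one of the following cases occurs: $\psi_i=\frac{1-\sqrt{-1}\,y}2e_{g_i}(x)$ and $C'_i=J_i(1,0)$; $\psi_i=\frac{1+\sqrt{-1}\,y}2e_{g_i}(x)$ and $C'_i=J_i(0,1)$; $\psi_i=0$ and $C'_i=0$; $\psi_i=e_{g_i}(x)$ and $C'_i=B_i$. For $1\le i\le\mu(n)$ and $q\equiv3\pmod4$, either $\psi_i=0$ and $C'_i=0$, or $\psi_i=e_{g_i}(x)$ and $C'_i=B_i$. 5. For $\mu(n)<i\le t$: $C'_i=0$ if $\psi_i=0$; $C'_i=B_i$ if $\psi_i=e_{g_i}(x)$; otherwise $C'_i=J_i(a,b)$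 for some $(a,b)\ne(0,0)$ in $L_i^2$. 6. For $t<i\le t+k$ and any $u_i,v_i,\tilde u_i,\tilde v_i\in\mathbb F_q[x]$ with $\psi_i=u_i(x)+yv_i(x)$ and $\tilde\psi_i=\tilde u_i(x)+y\tilde v_i(x)$: * $C'_i=B_i$ if $v_i(x)=\tilde v_i(x)=0$, $u_i(x)=e_{g_i}(x)$ and $\tilde u_i(x)=e_{g_i^*}(x)$ in $\mathbb F_q[Q_{4n}]$; * otherwise $C'_i=J_i(\tilde v_i(\beta_i^{-1}),-u_i(\beta_i))$ if $(\tilde v_i(\beta_i^{-1}),u_i(\beta_i))\ne(0,0)$; * otherwise $C'_i=J_i(\tilde u_i(\beta_i^{-1}),v_i(\beta_i))$ if $(\tilde u_i(\beta_i^{-1}),v_i(\beta_i))\ne(0,0)$; * $C'_i=0$ if all four of these values are $0$. -/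

import Mathlib

open Polynomial IntermediateField

namespace QuatCode

/-! ### Polynomials -/

/-- The reciprocal polynomial `g* = g(0)⁻¹ x^(deg g) g(x⁻¹)`. -/
noncomputable def recip {F : Type*} [Field F] (g : F[X]) : F[X] :=
  C (g.coeff 0)⁻¹ * g.reverse

/-- The polynomial `-[(ĝ)']^ / (2n) * (x^(2n) - 1) / g`, where the hat is coefficient reversal,
`ĝ = x^d g(x⁻¹)` with `d = deg g` and, on the derivative, `ĥ = x^(d-1) h(x⁻¹)`.  Modulo
`x^(2n) - 1` it is the generating idempotent of the ideal spanned by `(x^(2n) - 1) / g`. -/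
noncomputable def idemPoly {F : Type*} [Field F] (n : ℕ) (g : F[X]) : F[X] :=
  -(C (2 * n : F)⁻¹ * reflect (g.natDegree - 1) (derivative (reflect g.natDegree g)))
    * ((X ^ (2 * n) - 1) / g)

def delta (n : ℕ) : ℕ := if Even n then 2 else 1

def mu (n : ℕ) : ℕ := if Even n then 0 else 1

/-- A labelled factorization of `x^n - 1` and of `x^n + 1` into monic irreducible polynomials,
self-reciprocal factors first, then the pairs `h, h*`.  Labels start at `1`. -/
structure Factorization (F : Type*) [Field F] (n : ℕ) where
  (r s t k : ℕ)
  (f g : ℕ → F[X])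
  f_monic : ∀ j ∈ Finset.Icc 1 (r + s), (f j).Monic
  g_monic : ∀ i ∈ Finset.Icc 1 (t + k), (g i).Monic
  f_irreducible : ∀ j ∈ Finset.Icc 1 (r + s), Irreducible (f j)
  g_irreducible : ∀ i ∈ Finset.Icc 1 (t + k), Irreducible (g i)
  f_self : ∀ j ∈ Finset.Icc 1 r, recip (f j) = f j
  g_self : ∀ i ∈ Finset.Icc 1 t, recip (g i) = g i
  f_prod : (X ^ n - 1 : F[X]) =
    (∏ j ∈ Finset.Icc 1 r, f j) * ∏ j ∈ Finset.Ioc r (r + s), (f j * recip (f j))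
  g_prod : (X ^ n + 1 : F[X]) =
    (∏ i ∈ Finset.Icc 1 t, g i) * ∏ i ∈ Finset.Ioc t (t + k), (g i * recip (g i))
  f_one : f 1 = X - 1
  f_two : Even n → f 2 = X + 1
  g_one : Odd n → g 1 = X + 1

/-- The choices that enter the matrix realization of the group algebra: a root `α j` of `f j`,
a root `β i` of `g i`, a square root `ι` of `-1` in `F` when `q ≡ 1 (mod 4)`, and, for the
self-reciprocal `g i` with `i > μ(n)`, elements `a, b` of `F[β + β⁻¹]` with
`a² + (β + β⁻¹) a b + b² = -1` (these always exist over a finite field of odd order). -/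
structure RootData {F : Type*} [Field F] {n : ℕ} (D : Factorization F n)
    (E : Type*) [Field E] [Algebra F E] where
  (α β : ℕ → E)
  α_root : ∀ j ∈ Finset.Icc 1 (D.r + D.s), aeval (α j) (D.f j) = 0
  β_root : ∀ i ∈ Finset.Icc 1 (D.t + D.k), aeval (β i) (D.g i) = 0
  ι : F
  ι_sq : Nat.card F % 4 = 1 → ι ^ 2 = -1
  (a b : (i : ℕ) → F⟮β i + (β i)⁻¹⟯)
  ab_eq : ∀ i ∈ Finset.Ioc (mu n) D.t,
    a i ^ 2 + AdjoinSimple.gen F (β i + (β i)⁻¹) * a i * b i + b i ^ 2 = -1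

/-! ### The group algebra -/

/-- The group algebra `F[Q_{4n}]`. -/
abbrev GA (F : Type*) [Field F] (n : ℕ) : Type _ := MonoidAlgebra F (QuaternionGroup n)

noncomputable def xx (F : Type*) [Field F] (n : ℕ) : GA F n :=
  MonoidAlgebra.of F _ (QuaternionGroup.a 1)

noncomputable def yy (F : Type*) [Field F] (n : ℕ) : GA F n :=
  MonoidAlgebra.of F _ (QuaternionGroup.xa 0)

/-- The element `e_g(x)` of the group algebra. -/
noncomputable def idem {F : Type*} [Field F] (n : ℕ) (g : F[X]) : GA F n :=
  aeval (xx F n) (idemPoly n g)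

section lift

variable {M : Type*} [Monoid M] {n : ℕ} {x y : M}

theorem pow_val_add (h0 : n ≠ 0) (hx : x ^ (2 * n) = 1) (i j : ZMod (2 * n)) :
    x ^ (i + j).val = x ^ i.val * x ^ j.val := by
  have : NeZero (2 * n) := ⟨by omega⟩
  rw [ZMod.val_add, ← pow_add]
  exact (pow_eq_pow_mod _ hx).symm

theorem pow_mul_pow (hxy : x * y * x = y) (i : ℕ) : x ^ i * y * x ^ i = y := by
  induction i with
  | zero => simp
  | succ i ih =>
    calc x ^ (i + 1) * y * x ^ (i + 1) = x ^ i * (x * y * x) * x ^ i := by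
          rw [pow_succ x i]; nth_rewrite 2 [← pow_succ]; rw [pow_succ']; simp only [mul_assoc]
      _ = y := by rw [hxy, ih]

theorem pow_mul_pow_sub (h0 : n ≠ 0) (hx : x ^ (2 * n) = 1) (hxy : x * y * x = y)
    (i j : ZMod (2 * n)) : x ^ i.val * y * x ^ j.val = y * x ^ (j - i).val := by
  have h := pow_val_add h0 hx i (j - i)
  rw [add_sub_cancel] at h
  rw [h, ← mul_assoc, pow_mul_pow hxy]

/-- The homomorphism out of `Q_{4n}` given by images of `x`, `y` that satisfy the defining
relations `x^(2n) = 1`, `y² = x^n`, `x y x = y`. -/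
noncomputable def quatLift (h0 : n ≠ 0) (x y : M) (hx : x ^ (2 * n) = 1) (hy : y ^ 2 = x ^ n)
    (hxy : x * y * x = y) : QuaternionGroup n →* M where
  toFun
    | .a i => x ^ i.val
    | .xa i => y * x ^ i.val
  map_one' := by
    show x ^ (0 : ZMod (2 * n)).val = 1
    simp
  map_mul' := by
    rintro (i | i) (j | j)
    · show x ^ (i + j).val = _
      exact pow_val_add h0 hx i j
    · show y * x ^ (j - i).val = x ^ i.val * (y * x ^ j.val)
      rw [← mul_assoc, pow_mul_pow_sub h0 hx hxy]
    · show y * x ^ (i + j).val = y * x ^ i.val * x ^ j.val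
      rw [pow_val_add h0 hx, mul_assoc]
    · show x ^ ((n : ZMod (2 * n)) + j - i).val = y * x ^ i.val * (y * x ^ j.val)
      have hn : ((n : ZMod (2 * n))).val = n := by
        rw [ZMod.val_natCast]; exact Nat.mod_eq_of_lt (by omega)
      rw [add_sub_assoc, pow_val_add h0 hx, hn, ← hy, mul_assoc y, ← mul_assoc (x ^ i.val),
        pow_mul_pow_sub h0 hx hxy, pow_two, mul_assoc]

/-- The algebra homomorphism out of `F[Q_{4n}]` given by images of `x` and `y`. -/
noncomputable def algLift {F A : Type*} [Field F] [Ring A] [Algebra F A] (h0 : n ≠ 0) (x y : A)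
    (hx : x ^ n * x ^ n = 1) (hy : y ^ 2 = x ^ n) (hxy : x * y * x = y) : GA F n →ₐ[F] A :=
  MonoidAlgebra.lift F A (QuaternionGroup n)
    (quatLift h0 x y (by rw [two_mul, pow_add, hx]) hy hxy)

end lift

/-! ### Auxiliary facts for the realization -/

section aux

variable {F : Type*} [Field F] {n : ℕ} {E : Type*} [Field E] [Algebra F E] {D : Factorization F n}

section finite

variable [Finite F]

theorem ne_zero_of_coprime (hq : (4 * n).Coprime (Nat.card F)) : n ≠ 0 := by
  rintro rfl
  have := Finite.one_lt_card (α := F)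
  simp at hq
  omega

theorem cast_ne_zero_of_coprime {m : ℕ} (hq : m.Coprime (Nat.card F)) : (m : F) ≠ 0 := by
  intro h
  have : Fintype F := Fintype.ofFinite F
  have h1 : ((Nat.card F : ℕ) : F) = 0 := by
    rw [Nat.card_eq_fintype_card]; exact FiniteField.cast_card_eq_zero F
  have h2 := (Nat.isCoprime_iff_coprime.2 hq).map (Int.castRingHom F)
  simp only [eq_intCast, Int.cast_natCast, h, h1] at h2
  simp at h2

theorem two_ne_zero_of_coprime (hq : (4 * n).Coprime (Nat.card F)) : (2 : F) ≠ 0 := by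
  have := cast_ne_zero_of_coprime (F := F) (m := 2)
    (Nat.Coprime.coprime_dvd_left ⟨2 * n, by ring⟩ hq)
  exact_mod_cast this

theorem natCast_ne_zero_of_coprime (hq : (4 * n).Coprime (Nat.card F)) : (n : F) ≠ 0 :=
  cast_ne_zero_of_coprime (Nat.Coprime.coprime_dvd_left ⟨4, by ring⟩ hq)

end finite

theorem f_dvd (D : Factorization F n) {j : ℕ} (hj : j ∈ Finset.Icc 1 (D.r + D.s)) :
    D.f j ∣ X ^ n - 1 := by
  rw [D.f_prod]
  rw [Finset.mem_Icc] at hj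
  by_cases h : j ≤ D.r
  · exact Dvd.dvd.mul_right (Finset.dvd_prod_of_mem _ (by simp; omega)) _
  · exact Dvd.dvd.mul_left (dvd_trans (Dvd.intro _ rfl)
      (Finset.dvd_prod_of_mem (fun j => D.f j * recip (D.f j))
        (show j ∈ Finset.Ioc D.r (D.r + D.s) by simp; omega))) _

theorem g_dvd (D : Factorization F n) {j : ℕ} (hj : j ∈ Finset.Icc 1 (D.t + D.k)) :
    D.g j ∣ X ^ n + 1 := by
  rw [D.g_prod]
  rw [Finset.mem_Icc] at hj
  by_cases h : j ≤ D.t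
  · exact Dvd.dvd.mul_right (Finset.dvd_prod_of_mem _ (by simp; omega)) _
  · exact Dvd.dvd.mul_left (dvd_trans (Dvd.intro _ rfl)
      (Finset.dvd_prod_of_mem (fun j => D.g j * recip (D.g j))
        (show j ∈ Finset.Ioc D.t (D.t + D.k) by simp; omega))) _

theorem α_pow (R : RootData D E) {j : ℕ} (hj : j ∈ Finset.Icc 1 (D.r + D.s)) :
    R.α j ^ n = 1 := by
  obtain ⟨h, hh⟩ := f_dvd D hj
  have := congrArg (aeval (R.α j)) hh
  simp only [map_sub, map_pow, aeval_X, map_one, map_mul, R.α_root j hj, zero_mul] at this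
  exact sub_eq_zero.1 this

theorem β_pow (R : RootData D E) {j : ℕ} (hj : j ∈ Finset.Icc 1 (D.t + D.k)) :
    R.β j ^ n = -1 := by
  obtain ⟨h, hh⟩ := g_dvd D hj
  have := congrArg (aeval (R.β j)) hh
  simp only [map_add, map_pow, aeval_X, map_one, map_mul, R.β_root j hj, zero_mul] at this
  exact eq_neg_of_add_eq_zero_left this

theorem α_ne_zero [Finite F] (hq : (4 * n).Coprime (Nat.card F)) (R : RootData D E) {j : ℕ}
    (hj : j ∈ Finset.Icc 1 (D.r + D.s)) : R.α j ≠ 0 := by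
  intro h
  have := α_pow R hj
  rw [h, zero_pow (ne_zero_of_coprime hq)] at this
  exact zero_ne_one this

theorem β_ne_zero [Finite F] (hq : (4 * n).Coprime (Nat.card F)) (R : RootData D E) {j : ℕ}
    (hj : j ∈ Finset.Icc 1 (D.t + D.k)) : R.β j ≠ 0 := by
  intro h
  have := β_pow R hj
  rw [h, zero_pow (ne_zero_of_coprime hq)] at this
  simp at this

/-- A monic irreducible polynomial with a root `c` in the base field is `X - c`. -/
theorem eq_X_sub_C {p : F[X]} (hm : p.Monic) (hi : Irreducible p) {c : F}
    (h : aeval (algebraMap F E c) p = 0) : p = X - C c := by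
  rw [aeval_algebraMap_apply, map_eq_zero] at h
  have hd : X - C c ∣ p := dvd_iff_isRoot.2 (by simpa [IsRoot, aeval_def] using h)
  exact (eq_of_monic_of_associated (monic_X_sub_C c) hm
    ((irreducible_X_sub_C c).associated_of_dvd hi hd)).symm

theorem sq_not_dvd_prod {p : F[X]} (hs : Squarefree p) {t : Finset ℕ} {f : ℕ → F[X]} {h : F[X]}
    (hp : p = (∏ j ∈ t, f j) * h) {i j : ℕ} (hi : i ∈ t) (hj : j ∈ t) (hij : i ≠ j)
    (hirr : Irreducible (f i)) : f i ≠ f j := by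
  intro he
  apply hirr.not_isUnit
  apply hs
  rw [hp, ← Finset.mul_prod_erase t f hi,
    ← Finset.mul_prod_erase (t.erase i) f (Finset.mem_erase.2 ⟨hij.symm, hj⟩), ← he]
  exact ⟨(∏ x ∈ (t.erase i).erase j, f x) * h, by ring⟩

theorem α_sq_ne [Finite F] (hq : (4 * n).Coprime (Nat.card F)) (R : RootData D E) {j : ℕ}
    (hj : j ∈ Set.Ioc (delta n) D.r) : R.α j ≠ (R.α j)⁻¹ := by
  intro h
  obtain ⟨hj1, hj2⟩ := hj
  have h1 : 1 ≤ delta n := by unfold delta; split_ifs <;> omega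
  have hm : j ∈ Finset.Icc 1 (D.r + D.s) := by simp; omega
  have hn : NeZero (n : F) := ⟨natCast_ne_zero_of_coprime hq⟩
  have hs : Squarefree (X ^ n - 1 : F[X]) :=
    ((X_pow_sub_one_separable_iff).2 hn.out).squarefree
  have h2 : R.α j * R.α j = 1 := by
    nth_rewrite 2 [h]; exact mul_inv_cancel₀ (α_ne_zero hq R hm)
  rcases mul_self_eq_one_iff.1 h2 with h2 | h2
  · have := eq_X_sub_C (E := E) (c := 1) (D.f_monic j hm) (D.f_irreducible j hm)
      (by rw [map_one, ← h2]; exact R.α_root j hm)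
    exact sq_not_dvd_prod hs D.f_prod (i := j) (j := 1) (by simp; omega) (by simp; omega)
      (by omega) (D.f_irreducible j hm) (by rw [this, D.f_one, C_1])
  · by_cases hev : Even n
    · have h3 : delta n = 2 := by simp [delta, hev]
      have := eq_X_sub_C (E := E) (c := -1) (D.f_monic j hm) (D.f_irreducible j hm)
        (by rw [map_neg, map_one, ← h2]; exact R.α_root j hm)
      exact sq_not_dvd_prod hs D.f_prod (i := j) (j := 2) (by simp; omega) (by simp; omega)
        (by omega) (D.f_irreducible j hm) (by rw [this, D.f_two hev]; simp)
    · have h4 := α_pow R hm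
      rw [h2, (Nat.not_even_iff_odd.1 hev).neg_one_pow] at h4
      have h5 : algebraMap F E 2 = 0 := by
        rw [map_ofNat]; linear_combination -h4
      exact two_ne_zero_of_coprime hq ((map_eq_zero _).1 h5)

theorem β_sq_ne [Finite F] (hq : (4 * n).Coprime (Nat.card F)) (R : RootData D E) {j : ℕ}
    (hj : j ∈ Set.Ioc (mu n) D.t) : R.β j ≠ (R.β j)⁻¹ := by
  intro h
  obtain ⟨hj1, hj2⟩ := hj
  have hm : j ∈ Finset.Icc 1 (D.t + D.k) := by simp; omega
  have h20 : algebraMap F E 2 ≠ 0 := fun h =>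
    two_ne_zero_of_coprime hq ((map_eq_zero _).1 h)
  rw [map_ofNat] at h20
  have hs : Squarefree (X ^ n + 1 : F[X]) := by
    have := (separable_X_pow_sub_C (-1 : F) (natCast_ne_zero_of_coprime hq) (by simp)).squarefree
    simpa using this
  have h2 : R.β j * R.β j = 1 := by
    nth_rewrite 2 [h]; exact mul_inv_cancel₀ (β_ne_zero hq R hm)
  have h4 := β_pow R hm
  rcases mul_self_eq_one_iff.1 h2 with h2 | h2
  · rw [h2, one_pow] at h4
    exact h20 (by linear_combination h4)
  · rcases Nat.even_or_odd n with hev | hod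
    · rw [h2, hev.neg_one_pow] at h4
      exact h20 (by linear_combination h4)
    · have h3 : mu n = 1 := by simp [mu, hod]
      have := eq_X_sub_C (E := E) (c := -1) (D.g_monic j hm) (D.g_irreducible j hm)
        (by rw [map_neg, map_one, ← h2]; exact R.β_root j hm)
      exact sq_not_dvd_prod hs D.g_prod (i := j) (j := 1) (by simp; omega) (by simp; omega)
        (by omega) (D.g_irreducible j hm) (by rw [this, D.g_one hod]; simp)

/-- If `γ ≠ γ⁻¹` and `γ^n = c = ±1`, the matrix with trace `γ + γ⁻¹` below has `n`-th power `c`. -/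
theorem comp_pow (γ : E) (h0 : γ ≠ 0) (hγ : γ ≠ γ⁻¹) (c : F) (hc : γ ^ n = algebraMap F E c)
    (hc2 : c * c = 1) :
    (!![0, 1; -1, AdjoinSimple.gen F (γ + γ⁻¹)] : Matrix (Fin 2) (Fin 2) F⟮γ + γ⁻¹⟯) ^ n
      = algebraMap F _ c := by
  have hinv : γ⁻¹ ^ n = algebraMap F E c := by
    rw [inv_pow, hc]
    apply inv_eq_of_mul_eq_one_left
    rw [← map_mul, hc2, map_one]
  set m : F⟮γ + γ⁻¹⟯ →ₐ[F] E := F⟮γ + γ⁻¹⟯.val with hm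
  have hinj : Function.Injective (m.mapMatrix (m := Fin 2)) := fun A B h => by
    refine Matrix.ext fun i j => m.toRingHom.injective ?_
    exact congrFun (congrFun h i) j
  apply hinj
  rw [map_pow, AlgHom.commutes]
  have h1 : m.mapMatrix !![0, 1; -1, AdjoinSimple.gen F (γ + γ⁻¹)] = !![0, 1; -1, γ + γ⁻¹] := by
    ext i j
    fin_cases i <;> fin_cases j <;> simp [hm]
  rw [h1]
  have key : ∀ l : ℕ, (!![0, 1; -1, γ + γ⁻¹] : Matrix (Fin 2) (Fin 2) E) ^ l
      * !![1, 1; γ, γ⁻¹] = !![γ ^ l, γ⁻¹ ^ l; γ ^ (l + 1), γ⁻¹ ^ (l + 1)] := by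
    intro l
    induction l with
    | zero => simp
    | succ l ih =>
      rw [pow_succ', mul_assoc, ih]
      ext i j
      fin_cases i <;> fin_cases j <;> simp [Matrix.mul_apply, Fin.sum_univ_two] <;>
        field_simp <;> ring
  have hdet : IsUnit (!![1, 1; γ, γ⁻¹] : Matrix (Fin 2) (Fin 2) E) := by
    rw [Matrix.isUnit_iff_isUnit_det, Matrix.det_fin_two_of, isUnit_iff_ne_zero]
    intro h
    apply hγ
    linear_combination -h
  apply hdet.mul_right_cancel
  have h2 : algebraMap F (Matrix (Fin 2) (Fin 2) E) c
      = !![algebraMap F E c, 0; 0, algebraMap F E c] := by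
    ext i j
    fin_cases i <;> fin_cases j <;> simp [Matrix.algebraMap_matrix_apply]
  rw [key, pow_succ, pow_succ, hc, hinv, h2]
  ext i j
  fin_cases i <;> fin_cases j <;> simp [Matrix.mul_apply, Fin.sum_univ_two]

theorem diag_pow {K : Type*} [Field K] (γ : K) (c : K) (hc : γ ^ n = c) (hc2 : c * c = 1) :
    (!![γ, 0; 0, γ⁻¹] : Matrix (Fin 2) (Fin 2) K) ^ n = !![c, 0; 0, c] := by
  have hinv : γ⁻¹ ^ n = c := by
    rw [inv_pow, hc]
    exact inv_eq_of_mul_eq_one_left hc2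
  have : (!![γ, 0; 0, γ⁻¹] : Matrix (Fin 2) (Fin 2) K) = Matrix.diagonal ![γ, γ⁻¹] := by
    ext i j; fin_cases i <;> fin_cases j <;> simp
  rw [this, Matrix.diagonal_pow]
  ext i j; fin_cases i <;> fin_cases j <;> simp [hc, hinv]

theorem gen_pow {γ : E} {c : F} (hc : γ ^ n = algebraMap F E c) :
    AdjoinSimple.gen F γ ^ n = algebraMap F F⟮γ⟯ c := by
  apply Subtype.ext
  simpa using hc

end aux

/-! ### The components of the realization -/

section blocks

variable {F : Type*} [Field F] [Finite F] {n : ℕ} {D : Factorization F n}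
  {E : Type*} [Field E] [Algebra F E]

theorem even_of_mem {j : ℕ} (hj : j ∈ Set.Icc 1 (delta n)) (h : j ≠ 1) : Even n := by
  by_contra h'
  have h2 := hj.1
  have h3 := hj.2
  simp only [delta, h', if_false] at h3
  omega

theorem odd_of_mem {i : ℕ} (hi : i ∈ Set.Icc 1 (mu n)) : Odd n := by
  rw [← Nat.not_even_iff_odd]
  intro h'
  have h2 := hi.1
  have h3 := hi.2
  simp only [mu, h', if_true] at h3
  omega

/-- `τ_j` for `1 ≤ j ≤ δ(n)`: `x ↦ (ε, ε)`, `y ↦ (1, -1)`, with `ε = ±1` the root of `f_j`. -/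
noncomputable def tauLin (hq : (4 * n).Coprime (Nat.card F)) (j : Set.Icc 1 (delta n)) :
    GA F n →ₐ[F] F × F :=
  have hx : ((if j.1 = 1 then 1 else -1 : F × F)) ^ n = 1 := by
    split_ifs with h
    · simp
    · exact (even_of_mem j.2 h).neg_one_pow
  algLift (ne_zero_of_coprime hq) (if j.1 = 1 then 1 else -1) (1, -1)
    (by rw [hx, one_mul]) (by rw [hx]; ext <;> simp)
    (by split_ifs <;> simp)

/-- `τ_j` for `δ(n) < j ≤ r`: with `s = α_j + α_j⁻¹`, `x ↦ (0, 1; -1, s)`, `y ↦ (1, -s; 0, -1)`.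
Over `F[α_j]` this is conjugate to `x ↦ diag(α_j, α_j⁻¹)`, `y ↦ (0, 1; 1, 0)`. -/
noncomputable def tauSelf (hq : (4 * n).Coprime (Nat.card F)) (R : RootData D E)
    (j : Set.Ioc (delta n) D.r) :
    GA F n →ₐ[F] Matrix (Fin 2) (Fin 2) F⟮R.α j + (R.α j)⁻¹⟯ :=
  have hm : j.1 ∈ Finset.Icc 1 (D.r + D.s) := by
    have := j.2.1; have := j.2.2; simp; omega
  have hx := comp_pow (F := F) (n := n) (R.α j) (α_ne_zero hq R hm) (α_sq_ne hq R j.2) 1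
    (by rw [map_one]; exact α_pow R hm) (by simp)
  algLift (ne_zero_of_coprime hq)
    !![0, 1; -1, AdjoinSimple.gen F (R.α j + (R.α j)⁻¹)]
    !![1, -AdjoinSimple.gen F (R.α j + (R.α j)⁻¹); 0, -1]
    (by rw [hx, ← map_mul, one_mul, map_one])
    (by
      rw [hx, map_one, pow_two]
      ext i j; fin_cases i <;> fin_cases j <;> simp [Matrix.mul_apply, Fin.sum_univ_two])
    (by
      ext i j
      fin_cases i <;> fin_cases j <;> simp [Matrix.mul_apply, Fin.sum_univ_two])

/-- `τ_j` for `r < j ≤ r + s`: `x ↦ diag(α_j, α_j⁻¹)`, `y ↦ (0, 1; 1, 0)`. -/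
noncomputable def tauPair (hq : (4 * n).Coprime (Nat.card F)) (R : RootData D E)
    (j : Set.Ioc D.r (D.r + D.s)) :
    GA F n →ₐ[F] Matrix (Fin 2) (Fin 2) F⟮R.α j⟯ :=
  have hm : j.1 ∈ Finset.Icc 1 (D.r + D.s) := by
    have := j.2.1; have := j.2.2; simp; omega
  have hg : AdjoinSimple.gen F (R.α j) ≠ 0 := fun h =>
    α_ne_zero hq R hm (by simpa using congrArg Subtype.val h)
  have hx := diag_pow (n := n) (AdjoinSimple.gen F (R.α j)) 1
    (by simpa using gen_pow (F := F) (n := n) (γ := R.α j) (c := 1) (by simpa using α_pow R hm))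
    (by simp)
  algLift (ne_zero_of_coprime hq)
    !![AdjoinSimple.gen F (R.α j), 0; 0, (AdjoinSimple.gen F (R.α j))⁻¹]
    !![0, 1; 1, 0]
    (by rw [hx, ← Matrix.one_fin_two, one_mul])
    (by
      rw [hx, pow_two]
      ext i j; fin_cases i <;> fin_cases j <;> simp [Matrix.mul_apply, Fin.sum_univ_two])
    (by
      ext i j
      fin_cases i <;> fin_cases j <;> simp [Matrix.mul_apply, Fin.sum_univ_two, hg])

/-- `η_i` for `1 ≤ i ≤ μ(n)` and `q ≡ 1 (mod 4)`: `x ↦ (-1, -1)`, `y ↦ (√-1, -√-1)`. -/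
noncomputable def etaSplit (hq : (4 * n).Coprime (Nat.card F)) (R : RootData D E)
    (i : {i : ℕ // i ∈ Set.Icc 1 (mu n) ∧ Nat.card F % 4 = 1}) : GA F n →ₐ[F] F × F :=
  have hx : (-1 : F × F) ^ n = -1 := (odd_of_mem i.2.1).neg_one_pow
  algLift (ne_zero_of_coprime hq) (-1) (R.ι, -R.ι)
    (by rw [hx]; simp) (by rw [hx]; ext <;> simp [R.ι_sq i.2.2]) (by simp)

/-- `η_i` for `1 ≤ i ≤ μ(n)` and `q ≡ 3 (mod 4)`: `x ↦ -1`, `y ↦ √-1` in the field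
`F[√-1] = F[T] / (T² + 1)`. -/
noncomputable def etaField (hq : (4 * n).Coprime (Nat.card F))
    (i : {i : ℕ // i ∈ Set.Icc 1 (mu n) ∧ Nat.card F % 4 = 3}) :
    GA F n →ₐ[F] AdjoinRoot (X ^ 2 + 1 : F[X]) :=
  have hx : (-1 : AdjoinRoot (X ^ 2 + 1 : F[X])) ^ n = -1 := (odd_of_mem i.2.1).neg_one_pow
  algLift (ne_zero_of_coprime hq) (-1) (AdjoinRoot.root (X ^ 2 + 1 : F[X]))
    (by rw [hx]; simp)
    (by
      rw [hx]
      have h := AdjoinRoot.eval₂_root (X ^ 2 + 1 : F[X])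
      simp only [eval₂_add, eval₂_pow, eval₂_X, eval₂_one] at h
      exact eq_neg_of_add_eq_zero_left h)
    (by simp)

/-- `η_i` for `μ(n) < i ≤ t`: with `s = β_i + β_i⁻¹` and `a² + s a b + b² = -1`,
`x ↦ (0, 1; -1, s)`, `y ↦ (a, b; b + a s, -a)`. -/
noncomputable def etaSelf (hq : (4 * n).Coprime (Nat.card F)) (R : RootData D E)
    (i : Set.Ioc (mu n) D.t) :
    GA F n →ₐ[F] Matrix (Fin 2) (Fin 2) F⟮R.β i + (R.β i)⁻¹⟯ :=
  have hm : i.1 ∈ Finset.Icc 1 (D.t + D.k) := by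
    have := i.2.1; have := i.2.2; simp; omega
  have hx := comp_pow (F := F) (n := n) (R.β i) (β_ne_zero hq R hm) (β_sq_ne hq R i.2) (-1)
    (by rw [map_neg, map_one]; exact β_pow R hm) (by simp)
  have hab := R.ab_eq i.1 (by have := i.2.1; have := i.2.2; simp; omega)
  algLift (ne_zero_of_coprime hq)
    !![0, 1; -1, AdjoinSimple.gen F (R.β i + (R.β i)⁻¹)]
    !![R.a i, R.b i; R.b i + R.a i * AdjoinSimple.gen F (R.β i + (R.β i)⁻¹), -R.a i]
    (by rw [hx, ← map_mul, neg_one_mul, neg_neg, map_one])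
    (by
      rw [hx, map_neg, map_one, pow_two]
      have h := congrArg Subtype.val hab
      push_cast at h
      ext k l
      fin_cases k <;> fin_cases l <;> simp [Matrix.mul_apply, Fin.sum_univ_two] at h ⊢ <;>
        first | ring1 | linear_combination h)
    (by
      ext k l
      fin_cases k <;> fin_cases l <;> simp [Matrix.mul_apply, Fin.sum_univ_two] <;> ring1)

/-- `η_i` for `t < i ≤ t + k`: `x ↦ diag(β_i, β_i⁻¹)`, `y ↦ (0, 1; -1, 0)`. -/
noncomputable def etaPair (hq : (4 * n).Coprime (Nat.card F)) (R : RootData D E)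
    (i : Set.Ioc D.t (D.t + D.k)) :
    GA F n →ₐ[F] Matrix (Fin 2) (Fin 2) F⟮R.β i⟯ :=
  have hm : i.1 ∈ Finset.Icc 1 (D.t + D.k) := by
    have := i.2.1; have := i.2.2; simp; omega
  have hg : AdjoinSimple.gen F (R.β i) ≠ 0 := fun h =>
    β_ne_zero hq R hm (by simpa using congrArg Subtype.val h)
  have hx := diag_pow (n := n) (AdjoinSimple.gen F (R.β i)) (-1)
    (by simpa using gen_pow (F := F) (n := n) (γ := R.β i) (c := -1) (by simpa using β_pow R hm))
    (by simp)
  algLift (ne_zero_of_coprime hq)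
    !![AdjoinSimple.gen F (R.β i), 0; 0, (AdjoinSimple.gen F (R.β i))⁻¹]
    !![0, 1; -1, 0]
    (by
      rw [hx]
      ext i j; fin_cases i <;> fin_cases j <;> simp [Matrix.mul_apply, Fin.sum_univ_two])
    (by
      rw [hx, pow_two]
      ext i j; fin_cases i <;> fin_cases j <;> simp [Matrix.mul_apply, Fin.sum_univ_two])
    (by
      ext i j
      fin_cases i <;> fin_cases j <;> simp [Matrix.mul_apply, Fin.sum_univ_two, hg])

/-- The sum of the `A_j`, as an `F`-algebra. -/
abbrev ASum (R : RootData D E) : Type _ :=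
  (Set.Icc 1 (delta n) → F × F) ×
  ((j : Set.Ioc (delta n) D.r) → Matrix (Fin 2) (Fin 2) F⟮R.α j + (R.α j)⁻¹⟯) ×
  ((j : Set.Ioc D.r (D.r + D.s)) → Matrix (Fin 2) (Fin 2) F⟮R.α j⟯)

/-- The sum of the `B_i`, as an `F`-algebra.  At most one of the first two factors has a nonempty
index set, according to `q` modulo `4`. -/
abbrev BSum (R : RootData D E) : Type _ :=
  ({i : ℕ // i ∈ Set.Icc 1 (mu n) ∧ Nat.card F % 4 = 1} → F × F) ×
  ({i : ℕ // i ∈ Set.Icc 1 (mu n) ∧ Nat.card F % 4 = 3} → AdjoinRoot (X ^ 2 + 1 : F[X])) ×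
  ((i : Set.Ioc (mu n) D.t) → Matrix (Fin 2) (Fin 2) F⟮R.β i + (R.β i)⁻¹⟯) ×
  ((i : Set.Ioc D.t (D.t + D.k)) → Matrix (Fin 2) (Fin 2) F⟮R.β i⟯)

/-- The map `ρ`, with components the `τ_j` and the `η_i`. -/
noncomputable def rho (hq : (4 * n).Coprime (Nat.card F)) (R : RootData D E) :
    GA F n →ₐ[F] ASum R × BSum R :=
  AlgHom.prod
    (AlgHom.prod (AlgHom.pi fun j => tauLin hq j)
      (AlgHom.prod (AlgHom.pi fun j => tauSelf hq R j)
        (AlgHom.pi fun j => tauPair hq R j)))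
    (AlgHom.prod (AlgHom.pi fun i => etaSplit hq R i)
      (AlgHom.prod (AlgHom.pi fun i => etaField hq i)
        (AlgHom.prod (AlgHom.pi fun i => etaSelf hq R i)
          (AlgHom.pi fun i => etaPair hq R i))))

end blocks

/-! ### One-sided ideals of the summands -/

/-- `{(a x, b y) : a, b ∈ F}` in `F ⊕ F`. -/
def linIdeal {F : Type*} [Field F] (x y : F) : Set (F × F) :=
  {p | ∃ a b : F, p = (a * x, b * y)}

/-- `{(a y, -a x; b y, -b x) : a, b ∈ K}` in `Mat₂(K)`. -/
def matIdeal {K : Type*} [Field K] (x y : K) : Set (Matrix (Fin 2) (Fin 2) K) :=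
  {M | ∃ a b : K, M = !![a * y, -(a * x); b * y, -(b * x)]}

/-- The condition on the polynomials `u, v, u', v'` under which the block of a pair `h, h*` is the
full summand: `v'(x) = v(x) = 0`, `u(x) = e_h(x)` and `u'(x) = e_{h*}(x)` in the group algebra. -/
def FullCase {F : Type*} [Field F] (n : ℕ) (h u v u' v' : F[X]) : Prop :=
  aeval (xx F n) v' = 0 ∧ aeval (xx F n) v = 0 ∧
    aeval (xx F n) u = idem n h ∧ aeval (xx F n) u' = idem n (recip h)

/-- The left ideal `A z`. -/
def leftIdeal {A : Type*} [Ring A] (z : A) : Set A := {w | ∃ c : A, w = c * z}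

end QuatCode

namespace QuatCode

/-! ### The idempotent polynomials -/

section poly

variable {F : Type*} [Field F]

/-! Every element of the group algebra has the form `P(x) + y Q(x)`. Each component `τ` of `ρ` is
shown to be surjective with kernel exactly the elements where a polynomial `p` divides both `P` and
`Q`; here `p` is a self-reciprocal factor or a product `f f*`. This is `IsBlock`. The polynomials
`p` are pairwise coprime with product `x^(2n) - 1`, so the Chinese remainder theorem makes `ρ` an
isomorphism (`dvd_of_rho_eq_zero`, `rho_surjective`), and a left ideal generated by one element maps
onto the direct sum of its blocks.

The reversed derivative in `e_g` is a disguise: up to sign it is `x g' - d g`. If `g h = x^(2n) -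
1`, then `g' h + g h' = 2n x^(2n-1)`, hence `x g' h ≡ 2n` modulo `g` and `e_g ≡ 1` modulo `g`, while
`e_g` is a multiple of `h`. So, with `e` the idempotent of a block (for a pair, `e_f + e_{f*}`), `τ
e = 1` and `e` is annihilated on the left by `ker τ`. Therefore `z e = w e` if and only if `τ z = τ
w` (`mul_aeval_eq_mul_aeval_iff`): the product `λ e` carries the same information as `τ λ`, and the
block of the code is the left ideal generated by `τ λ`.

What remains is to list the left ideals generated by an idempotent in `F × F`, in a domain, and in
`Mat₂(K)`. In the matrix case an idempotent other than `1` is singular, so any nonzero row generates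
the row space and determines the ideal. For a pair `f, f*` the elements `e_f` and `e_{f*}` map to
the two diagonal matrix units, so the two products display the columns of `τ λ`; this gives the
explicit generators. -/

theorem neg_reflect_derivative_reflect {g : F[X]} (hd : 1 ≤ g.natDegree) :
    -reflect (g.natDegree - 1) (derivative (reflect g.natDegree g))
      = X * derivative g - C (g.natDegree : F) * g := by
  ext k
  rw [coeff_neg, coeff_sub, coeff_C_mul, coeff_reflect, coeff_derivative, coeff_reflect]
  have hX : (X * derivative g).coeff k = k * g.coeff k := by
    cases k with
    | zero => simp
    | succ k => rw [coeff_X_mul, coeff_derivative]; push_cast; ring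
  rw [hX]
  -- Below the degree `d` the two reversals compose to give the coefficient `(k - d) g_k`. For `k ≥
  -- d`, `revAt` fixes the indices `k` and `k + 1`, so a coefficient of `g` above its degree
  -- appears; the other side vanishes too, at `k = d` because of the factor `k - d`.
  rcases lt_or_ge k g.natDegree with hk | hk
  · rw [revAt_le (show k ≤ g.natDegree - 1 by omega),
      revAt_le (show g.natDegree - 1 - k + 1 ≤ g.natDegree by omega)]
    have h1 : g.natDegree - (g.natDegree - 1 - k + 1) = k := by omega
    have h2 : g.natDegree - 1 - k = g.natDegree - (k + 1) := by omega
    rw [h1, h2, Nat.cast_sub (by omega)]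
    push_cast
    ring
  · have h1 : revAt (g.natDegree - 1) k = k := by
      rw [← revAtFun_eq, revAtFun, if_neg (by omega)]
    rw [h1]
    have h2 : revAt g.natDegree (k + 1) = k + 1 := by
      rw [← revAtFun_eq, revAtFun, if_neg (by omega)]
    rw [h2, coeff_eq_zero_of_natDegree_lt (show g.natDegree < k + 1 by omega)]
    rcases hk.eq_or_lt with rfl | hk
    · ring
    · rw [coeff_eq_zero_of_natDegree_lt hk]; ring

theorem idemPoly_eq (n : ℕ) {g : F[X]} (hd : 1 ≤ g.natDegree) :
    idemPoly n g = C (2 * n : F)⁻¹ * (X * derivative g - C (g.natDegree : F) * g)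
      * ((X ^ (2 * n) - 1) / g) := by
  rw [← neg_reflect_derivative_reflect hd, idemPoly]
  ring

variable {n : ℕ} {g : F[X]}

theorem dvd_mul_idemPoly (hd : 1 ≤ g.natDegree) (hg : g ∣ X ^ (2 * n) - 1) :
    X ^ (2 * n) - 1 ∣ g * idemPoly n g := by
  have h0 : g ≠ 0 := by rintro rfl; simp at hd
  rw [idemPoly_eq n hd]
  refine ⟨C (2 * n : F)⁻¹ * (X * derivative g - C (g.natDegree : F) * g), ?_⟩
  nth_rewrite 2 [← EuclideanDomain.mul_div_cancel' h0 hg]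
  ring

/-- Differentiating `g h = x^(2n) - 1` and multiplying by `x` turns `x g' h` into `2n x^(2n) - x g
h'`, and `x^(2n) ≡ 1` modulo `g`. -/
theorem dvd_idemPoly_sub_one (h2n : (2 * n : F) ≠ 0) (hd : 1 ≤ g.natDegree)
    (hg : g ∣ X ^ (2 * n) - 1) : g ∣ idemPoly n g - 1 := by
  have h0 : g ≠ 0 := by rintro rfl; simp at hd
  have hn : n ≠ 0 := by rintro rfl; simp at h2n
  rw [idemPoly_eq n hd]
  have hh := EuclideanDomain.mul_div_cancel' h0 hg
  set h := (X ^ (2 * n) - 1) / g with hdef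
  have hder := congrArg derivative hh
  rw [derivative_mul, derivative_sub, derivative_X_pow, derivative_one, sub_zero] at hder
  have hX : (X : F[X]) * X ^ (2 * n - 1) = X ^ (2 * n) := by
    rw [← pow_succ']; congr 1; omega
  have hC : C (2 * n : F)⁻¹ * C (2 * n : F) = 1 := by
    rw [← C_mul, inv_mul_cancel₀ h2n, C_1]
  push_cast at hder
  -- After replacing `x g' h`, the difference `e_g - 1` is `(x^(2n) - 1) - g (x h' + d h) / (2n)`;
  -- the quotient by `g` is read off using `x^(2n) - 1 = g h`.
  refine ⟨h - C (2 * n : F)⁻¹ * (X * derivative h + C (g.natDegree : F) * h), ?_⟩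
  have e : C (2 * n : F) = (2 * n : F[X]) := by rw [C_mul, C_ofNat, C_eq_natCast]
  rw [e] at hC hder
  linear_combination (C (2 * n : F)⁻¹ * X) * hder + hC * (X ^ (2 * n)) +
    (C (2 * n : F)⁻¹ * (2 * n : F[X])) * hX - hh

theorem dvd_idemPoly_of_isCoprime {p : F[X]} (hd : 1 ≤ g.natDegree) (hg : g ∣ X ^ (2 * n) - 1)
    (hp : p ∣ X ^ (2 * n) - 1) (hpg : IsCoprime p g) : p ∣ idemPoly n g :=
  hpg.dvd_of_dvd_mul_left (hp.trans (dvd_mul_idemPoly hd hg))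

end poly

/-! ### Reciprocal polynomials -/

section recip

variable {F E : Type*} [Field F] [Field E] [Algebra F E]

theorem aeval_inv_recip {g : F[X]} (h0 : g.coeff 0 ≠ 0) {γ : E} (hγ : γ ≠ 0) :
    aeval γ⁻¹ (recip g) = 0 ↔ aeval γ g = 0 := by
  have := invertibleOfNonzero hγ
  have h := eval₂_reverse_eq_zero_iff (algebraMap F E) γ g
  rw [invOf_eq_inv] at h
  rw [recip, map_mul, aeval_C, mul_eq_zero, aeval_def, h, aeval_def]
  simp [h0]

theorem aeval_recip {g : F[X]} (h0 : g.coeff 0 ≠ 0) {γ : E} (hγ : γ ≠ 0) :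
    aeval γ (recip g) = 0 ↔ aeval γ⁻¹ g = 0 := by
  simpa using aeval_inv_recip h0 (inv_ne_zero hγ)

theorem recip_monic {g : F[X]} (h0 : g.coeff 0 ≠ 0) : (recip g).Monic := by
  rw [Monic, recip, leadingCoeff_mul, leadingCoeff_C, reverse_leadingCoeff, trailingCoeff,
    natTrailingDegree_eq_zero.2 (Or.inr h0), inv_mul_cancel₀ h0]

theorem dvd_of_aeval_eq_zero {g : F[X]} (hm : g.Monic) (hi : Irreducible g) {γ : E}
    (h : aeval γ g = 0) {P : F[X]} : g ∣ P ↔ aeval γ P = 0 := by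
  rw [minpoly.eq_of_irreducible_of_monic hi h hm]
  exact minpoly.dvd_iff

/-- The reciprocal is monic and kills `γ⁻¹`. Its degree is at most `deg g = [F(γ) : F] = [F(γ⁻¹) :
F]`, so it cannot be a proper multiple of the minimal polynomial. -/
theorem recip_eq_minpoly {g : F[X]} (h0 : g.coeff 0 ≠ 0) (hm : g.Monic) (hi : Irreducible g)
    {γ : E} (hγ : γ ≠ 0) (h : aeval γ g = 0) : recip g = minpoly F γ⁻¹ := by
  have hint : IsIntegral F γ := ⟨g, hm, h⟩
  have hint' : IsIntegral F γ⁻¹ := hint.inv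
  refine eq_of_monic_of_dvd_of_natDegree_le (minpoly.monic hint') (recip_monic h0)
    (minpoly.dvd _ _ ((aeval_inv_recip h0 hγ).2 h)) ?_
  have e : F⟮γ⁻¹⟯ = F⟮γ⟯ := by
    apply le_antisymm <;> rw [adjoin_simple_le_iff]
    · exact inv_mem (mem_adjoin_simple_self F γ)
    · simpa using inv_mem (mem_adjoin_simple_self F γ⁻¹)
  rw [← IntermediateField.adjoin.finrank hint', e, IntermediateField.adjoin.finrank hint,
    ← minpoly.eq_of_irreducible_of_monic hi h hm]
  exact (natDegree_C_mul_le _ _).trans (reverse_natDegree_le g)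

theorem recip_irreducible {g : F[X]} (h0 : g.coeff 0 ≠ 0) (hm : g.Monic) (hi : Irreducible g)
    {γ : E} (hγ : γ ≠ 0) (h : aeval γ g = 0) : Irreducible (recip g) := by
  rw [recip_eq_minpoly h0 hm hi hγ h]
  exact minpoly.irreducible (IsIntegral.inv ⟨g, hm, h⟩)

end recip

/-! ### Elements of the group algebra -/

section GA

variable {F : Type*} [Field F] {n : ℕ}

theorem xx_pow (hn : n ≠ 0) : xx F n ^ (2 * n) = 1 := by
  have : NeZero n := ⟨hn⟩
  rw [xx, ← map_pow]
  have : (QuaternionGroup.a 1 : QuaternionGroup n) ^ (2 * n) = 1 := by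
    rw [QuaternionGroup.a_one_pow_n]
  rw [this, map_one]

theorem a_natCast (k : ℕ) :
    MonoidAlgebra.of F _ (QuaternionGroup.a (k : ZMod (2 * n))) = xx F n ^ k := by
  rw [xx, ← map_pow, QuaternionGroup.a_one_pow]

/-- The group consists of the `x^i` and the `y x^i`. This normal form reduces every question about
kernels to divisibility of two polynomials. -/
theorem exists_repr (hn : n ≠ 0) (z : GA F n) :
    ∃ P Q : F[X], z = aeval (xx F n) P + yy F n * aeval (xx F n) Q := by
  have : NeZero (2 * n) := ⟨by omega⟩
  induction z using MonoidAlgebra.induction_on with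
  | of g =>
    rcases g with i | i
    · refine ⟨X ^ i.val, 0, ?_⟩
      rw [map_zero, mul_zero, add_zero, map_pow, aeval_X, ← a_natCast, ZMod.natCast_zmod_val]
    · refine ⟨0, X ^ i.val, ?_⟩
      rw [map_zero, zero_add, map_pow, aeval_X, ← a_natCast, ZMod.natCast_zmod_val, yy, ← map_mul]
      simp
  | add z w hz hw =>
    obtain ⟨P, Q, rfl⟩ := hz
    obtain ⟨P', Q', rfl⟩ := hw
    exact ⟨P + P', Q + Q', by simp only [map_add, mul_add]; abel⟩
  | smul c z hz =>
    obtain ⟨P, Q, rfl⟩ := hz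
    exact ⟨c • P, c • Q, by simp only [map_smul, mul_smul_comm, smul_add]⟩

theorem aeval_xx_eq_zero (hn : n ≠ 0) {P : F[X]} (h : X ^ (2 * n) - 1 ∣ P) :
    aeval (xx F n) P = 0 := by
  obtain ⟨Q, rfl⟩ := h
  rw [map_mul, map_sub, map_pow, aeval_X, xx_pow hn, map_one, sub_self, zero_mul]

theorem algLift_xx {A : Type*} [Ring A] [Algebra F A] (h0 : n ≠ 0) (x y : A)
    (hx : x ^ n * x ^ n = 1) (hy : y ^ 2 = x ^ n) (hxy : x * y * x = y) :
    algLift (F := F) h0 x y hx hy hxy (xx F n) = x := by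
  have : Fact (1 < 2 * n) := ⟨by omega⟩
  rw [algLift, xx, MonoidAlgebra.lift_of]
  show x ^ (1 : ZMod (2 * n)).val = x
  rw [ZMod.val_one, pow_one]

theorem algLift_yy {A : Type*} [Ring A] [Algebra F A] (h0 : n ≠ 0) (x y : A)
    (hx : x ^ n * x ^ n = 1) (hy : y ^ 2 = x ^ n) (hxy : x * y * x = y) :
    algLift (F := F) h0 x y hx hy hxy (yy F n) = y := by
  rw [algLift, yy, MonoidAlgebra.lift_of]
  show y * x ^ (0 : ZMod (2 * n)).val = y
  rw [ZMod.val_zero, pow_zero, mul_one]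

end GA

/-! ### Blocks of the group algebra -/

section block

variable {F : Type*} [Field F] {n : ℕ} {A : Type*} [Ring A] [Algebra F A]

/-- A homomorphism that realizes the quotient of `F[Q_{4n}]` by the ideal generated by `p(x)`. -/
structure IsBlock (τ : GA F n →ₐ[F] A) (p : F[X]) : Prop where
  surjective : Function.Surjective τ
  map_eq_zero_iff : ∀ P Q : F[X],
    τ (aeval (xx F n) P + yy F n * aeval (xx F n) Q) = 0 ↔ p ∣ P ∧ p ∣ Q

namespace IsBlock

variable {τ : GA F n →ₐ[F] A} {p : F[X]}

theorem map_aeval_eq_zero_iff (h : IsBlock τ p) (P : F[X]) :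
    τ (aeval (xx F n) P) = 0 ↔ p ∣ P := by
  simpa using h.map_eq_zero_iff P 0

theorem map_aeval_eq_one (h : IsBlock τ p) {e : F[X]} (he : p ∣ e - 1) :
    τ (aeval (xx F n) e) = 1 := by
  rw [← sub_eq_zero, ← map_one τ, ← map_sub,
    ← map_one (aeval (R := F) (xx F n)), ← map_sub,
    h.map_aeval_eq_zero_iff]
  exact he

/-- A kernel element is `p(x) P(x) + y p(x) Q(x)`. Polynomials in `x` commute with one another, so
right multiplication by `e(x)` produces the factor `p e`, a multiple of `x^(2n) - 1`, in both terms.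
-/
theorem mul_aeval_eq_zero (hn : n ≠ 0) (h : IsBlock τ p) {e : F[X]}
    (he : X ^ (2 * n) - 1 ∣ p * e) {z : GA F n} (hz : τ z = 0) : z * aeval (xx F n) e = 0 := by
  obtain ⟨P, Q, rfl⟩ := exists_repr hn z
  obtain ⟨⟨P, rfl⟩, ⟨Q, rfl⟩⟩ := (h.map_eq_zero_iff P Q).1 hz
  have key : ∀ P : F[X], aeval (xx F n) (p * P) * aeval (xx F n) e = 0 := fun P => by
    rw [← map_mul]
    refine aeval_xx_eq_zero hn (he.trans ⟨P, by ring⟩)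
  rw [add_mul, mul_assoc, key, key, mul_zero, add_zero]

/-- The dictionary of the whole proof: identities between products with `e` in the group algebra are
identities in the block. Forward because `τ e = 1`, backward because `e` is killed by the kernel. -/
theorem mul_aeval_eq_mul_aeval_iff (hn : n ≠ 0) (h : IsBlock τ p) {e : F[X]} (he1 : p ∣ e - 1)
    (he : X ^ (2 * n) - 1 ∣ p * e) {z w : GA F n} :
    z * aeval (xx F n) e = w * aeval (xx F n) e ↔ τ z = τ w := by
  constructor
  · intro hzw
    have := congrArg τ hzw
    rwa [map_mul, map_mul, h.map_aeval_eq_one he1, mul_one, mul_one] at this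
  · intro hzw
    rw [← sub_eq_zero, ← sub_mul]
    exact h.mul_aeval_eq_zero hn he (by rw [map_sub, hzw, sub_self])

theorem image_span (h : IsBlock τ p) (lam : GA F n) :
    τ '' (Ideal.span {lam} : Ideal (GA F n)) = leftIdeal (τ lam) := by
  ext w
  constructor
  · rintro ⟨z, hz, rfl⟩
    obtain ⟨c, rfl⟩ := Ideal.mem_span_singleton'.1 hz
    exact ⟨τ c, map_mul _ _ _⟩
  · rintro ⟨c, rfl⟩
    obtain ⟨c, rfl⟩ := h.surjective c
    exact ⟨c * lam, Ideal.mem_span_singleton'.2 ⟨c, rfl⟩, map_mul _ _ _⟩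

end IsBlock

end block

/-! ### Two-dimensional blocks -/

section two

variable {F : Type*} [Field F] {n : ℕ}

theorem aeval_diag {K : Type*} [Field K] [Algebra F K] (γ γ' : K) (P : F[X]) :
    aeval (!![γ, 0; 0, γ'] : Matrix (Fin 2) (Fin 2) K) P = !![aeval γ P, 0; 0, aeval γ' P] := by
  induction P using Polynomial.induction_on' with
  | add P Q hP hQ =>
    rw [map_add, hP, hQ, map_add, map_add]
    ext i j; fin_cases i <;> fin_cases j <;> simp
  | monomial k c =>
    have hD : ∀ k : ℕ, (!![γ, 0; 0, γ'] : Matrix (Fin 2) (Fin 2) K) ^ k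
        = !![γ ^ k, 0; 0, γ' ^ k] := by
      intro k
      induction k with
      | zero => simp [Matrix.one_fin_two]
      | succ k ih => rw [pow_succ, ih]; simp [pow_succ]
    rw [aeval_monomial, hD, aeval_monomial, aeval_monomial, ← Algebra.smul_def]
    ext i j; fin_cases i <;> fin_cases j <;> simp [Algebra.smul_def]

theorem aeval_mul_of_semiconj {A : Type*} [Ring A] [Algebra F A] {x d v : A}
    (h : x * v = v * d) (P : F[X]) : aeval x P * v = v * aeval d P := by
  induction P using Polynomial.induction_on with
  | C c => rw [aeval_C, aeval_C, Algebra.commutes]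
  | add P Q hP hQ => rw [map_add, map_add, add_mul, mul_add, hP, hQ]
  | monomial k c ih =>
    rw [pow_succ, ← mul_assoc, map_mul _ _ X, map_mul _ _ X, aeval_X, aeval_X, mul_assoc, h,
      ← mul_assoc, ih, mul_assoc]

/-- In the basis `V`, `P(x)` is diagonal and `y Q(x)` is antidiagonal, so they cannot cancel. The
four entries are values of `P` and `Q` at the two eigenvalues, up to the nonzero factors `κ`, `κ'`.
-/
theorem map_eq_zero_iff_of_diag {K : Type*} [Field K] [Algebra F K]
    (τ : GA F n →ₐ[F] Matrix (Fin 2) (Fin 2) K) {V : Matrix (Fin 2) (Fin 2) K} (hV : IsUnit V)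
    {γ γ' κ κ' : K} (hκ : κ ≠ 0) (hκ' : κ' ≠ 0)
    (hx : τ (xx F n) * V = V * !![γ, 0; 0, γ']) (hy : τ (yy F n) * V = V * !![0, κ'; κ, 0])
    (P Q : F[X]) :
    τ (aeval (xx F n) P + yy F n * aeval (xx F n) Q) = 0 ↔
      (aeval γ P = 0 ∧ aeval γ' P = 0) ∧ aeval γ Q = 0 ∧ aeval γ' Q = 0 := by
  rw [← hV.mul_left_eq_zero, map_add, map_mul, ← aeval_algHom_apply, ← aeval_algHom_apply,
    add_mul, mul_assoc, aeval_mul_of_semiconj hx, aeval_mul_of_semiconj hx, ← mul_assoc, hy,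
    mul_assoc, ← mul_add, hV.mul_right_eq_zero, aeval_diag, aeval_diag, ← Matrix.ext_iff]
  simp [Fin.forall_fin_two, hκ, hκ']
  tauto

theorem exists_aeval_gen {E : Type*} [Field E] [Algebra F E] {γ : E} (h : IsIntegral F γ)
    (u : F⟮γ⟯) : ∃ P : F[X], aeval (AdjoinSimple.gen F γ) P = u := by
  have hu : (u : E) ∈ F⟮γ⟯.toSubalgebra := u.2
  rw [adjoin_simple_toSubalgebra_of_isAlgebraic h.isAlgebraic,
    Algebra.adjoin_singleton_eq_range_aeval] at hu
  obtain ⟨P, hP⟩ := hu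
  refine ⟨P, Subtype.ext ?_⟩
  rw [← hP]
  exact (aeval_algHom_apply F⟮γ⟯.val (AdjoinSimple.gen F γ) P).symm

/-- Since `f` and `f*` are the minimal polynomials of `γ` and `γ⁻¹` and are coprime, vanishing at
both points is divisibility by `f f*`. Coprimality also supplies the upper left matrix unit;
multiplying it by `y` on either side gives the others. -/
theorem isBlock_pair {K : Type*} [Field K] [Algebra F K]
    (τ : GA F n →ₐ[F] Matrix (Fin 2) (Fin 2) K) {γ c : K} (hγ : γ ≠ 0) (hc : c ≠ 0)
    (hx : τ (xx F n) = !![γ, 0; 0, γ⁻¹]) (hy : τ (yy F n) = !![0, 1; c, 0])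
    (hgen : ∀ u : K, ∃ P : F[X], aeval γ P = u) {f : F[X]} (h0 : f.coeff 0 ≠ 0) (hm : f.Monic)
    (hi : Irreducible f) (hf : aeval γ f = 0) (hco : IsCoprime f (recip f)) :
    IsBlock τ (f * recip f) := by
  have hdvd : ∀ P : F[X], f * recip f ∣ P ↔ aeval γ P = 0 ∧ aeval γ⁻¹ P = 0 := fun P => by
    rw [← dvd_of_aeval_eq_zero hm hi hf, ← dvd_of_aeval_eq_zero (recip_monic h0)
      (recip_irreducible h0 hm hi hγ hf) ((aeval_inv_recip h0 hγ).2 hf)]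
    exact ⟨fun h => ⟨dvd_of_mul_right_dvd h, dvd_of_mul_left_dvd h⟩,
      fun h => hco.mul_dvd h.1 h.2⟩
  refine ⟨fun M => ?_, fun P Q => ?_⟩
  · obtain ⟨s, t, hst⟩ := hco
    have hD : ∀ u : K, ∃ z, τ z = !![u, 0; 0, 0] := fun u => by
      obtain ⟨P, rfl⟩ := hgen u
      -- The Bézout term `t f*` takes the value `1` at `γ` and `0` at `γ⁻¹`.
      refine ⟨aeval (xx F n) (P * (t * recip f)), ?_⟩
      have h1 := congrArg (aeval γ) hst
      rw [map_add, map_mul, hf, mul_zero, zero_add, map_one] at h1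
      rw [← aeval_algHom_apply, hx, aeval_diag, map_mul, h1, map_mul, map_mul,
        (aeval_inv_recip h0 hγ).2 hf, mul_zero, mul_zero, mul_one]
    obtain ⟨z1, h1⟩ := hD (M 0 0)
    obtain ⟨z2, h2⟩ := hD (M 0 1)
    obtain ⟨z3, h3⟩ := hD (M 1 0 * c⁻¹)
    obtain ⟨z4, h4⟩ := hD (M 1 1 * c⁻¹)
    refine ⟨z1 + z2 * yy F n + yy F n * z3 + yy F n * z4 * yy F n, ?_⟩
    simp only [map_add, map_mul, h1, h2, h3, h4, hy]
    ext i j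
    fin_cases i <;> fin_cases j <;> simp <;> field_simp
  · rw [hdvd, hdvd]
    exact map_eq_zero_iff_of_diag τ isUnit_one hc one_ne_zero (by rw [hx, mul_one, one_mul])
      (by rw [hy, mul_one, one_mul]) P Q

/-- Write `X`, `Y` for the images of `x`, `y`. The form `a² + s a b + b² = c` says `Y² = c`. The
scalars `K = F[s]` lie in the image, and `1, X, Y, XY` form a `K`-basis of the matrices once `s² -
4` and `c` are nonzero. -/
theorem surjective_of_companion {K : Type*} [Field K] [Algebra F K]
    (τ : GA F n →ₐ[F] Matrix (Fin 2) (Fin 2) K) {s a b : K} {c : F} (hc : c ≠ 0)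
    (habc : a ^ 2 + s * a * b + b ^ 2 = algebraMap F K c) (hs : s ^ 2 - 4 ≠ 0)
    (hx : τ (xx F n) = !![0, 1; -1, s]) (hy : τ (yy F n) = !![a, b; b + a * s, -a])
    (hgen : ∀ u : K, ∃ P : F[X], aeval s P = u) : Function.Surjective τ := by
  have hcK : algebraMap F K c ≠ 0 := fun h => hc ((map_eq_zero _).1 h)
  -- From `X Y X = Y` and `Y² = c` comes `Y X Y = c X⁻¹`, so this element maps to `c (X + X⁻¹)`, the
  -- scalar `c s`.
  have hs' : τ (c • xx F n + yy F n * xx F n * yy F n) = algebraMap K _ (algebraMap F K c * s) := by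
    rw [map_add, map_smul, map_mul, map_mul, hx, hy, ← algebraMap_smul K c, ← habc]
    ext i j
    fin_cases i <;> fin_cases j <;>
      simp [Matrix.algebraMap_matrix_apply] <;> ring
  have hS : ∀ u : K, ∃ z, τ z = algebraMap _ _ u := fun u => by
    obtain ⟨P, rfl⟩ := hgen u
    refine ⟨aeval (c⁻¹ • (c • xx F n + yy F n * xx F n * yy F n)) P, ?_⟩
    rw [← aeval_algHom_apply, map_smul, hs', map_mul, ← IsScalarTower.algebraMap_apply,
      ← Algebra.smul_def, smul_smul, inv_mul_cancel₀ hc, one_smul, aeval_algebraMap_apply]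
  intro M
  obtain ⟨m1, m2, m3, m4, rfl⟩ : ∃ m1 m2 m3 m4, M = !![m1, m2; m3, m4] :=
    ⟨_, _, _, _, Matrix.eta_fin_two M⟩
  -- Target: `M = p0 + p1 X + q0 Y + q1 XY`. As `Y`, `XY` and `X²Y` have trace zero, the traces of
  -- `M` and `XM` give `2 p0 + s p1 = m1 + m4` and `s p0 + (s² - 2) p1 = m3 - m2 + s m4`, a system
  -- of determinant `s² - 4`.
  obtain ⟨p0, hp0⟩ : ∃ p0 : K,
      p0 * (s ^ 2 - 4) = (s ^ 2 - 2) * (m1 + m4) - s * (m3 - m2 + s * m4) :=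
    ⟨_, div_mul_cancel₀ _ hs⟩
  obtain ⟨p1, hp1⟩ : ∃ p1 : K,
      p1 * (s ^ 2 - 4) = 2 * (m3 - m2 + s * m4) - s * (m1 + m4) :=
    ⟨_, div_mul_cancel₀ _ hs⟩
  -- The first row of `M - p0 - p1 X` must equal `q0 (a, b) + q1 (b + a s, -a)`, a system of
  -- determinant `-c`. The second row then follows from the two trace equations.
  obtain ⟨q0, hq0⟩ : ∃ q0 : K,
      q0 * algebraMap F K c = (m1 - p0) * a + (m2 - p1) * (b + a * s) :=
    ⟨_, div_mul_cancel₀ _ hcK⟩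
  obtain ⟨q1, hq1⟩ : ∃ q1 : K, q1 * algebraMap F K c = (m1 - p0) * b - (m2 - p1) * a :=
    ⟨_, div_mul_cancel₀ _ hcK⟩
  obtain ⟨z1, h1⟩ := hS p0
  obtain ⟨z2, h2⟩ := hS p1
  obtain ⟨z3, h3⟩ := hS q0
  obtain ⟨z4, h4⟩ := hS q1
  rw [← habc] at hq0 hq1 hcK
  have e1 : p0 + q0 * a + q1 * (b + a * s) = m1 := by
    apply mul_right_cancel₀ hcK
    linear_combination a * hq0 + (b + a * s) * hq1
  have e2 : p1 + q0 * b - q1 * a = m2 := by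
    apply mul_right_cancel₀ hcK
    linear_combination b * hq0 - a * hq1
  have e3 : -p1 + q0 * (b + a * s) + q1 * (-a + s * (b + a * s)) = m3 := by
    have : -p1 + (m2 - p1) + s * (m1 - p0) = m3 := by
      apply mul_right_cancel₀ hs
      linear_combination -2 * hp1 - s * hp0
    linear_combination this + e2 + s * e1
  have e4 : p0 + p1 * s - q0 * a + q1 * (-b - s * a) = m4 := by
    have : p0 + p1 * s - (m1 - p0) = m4 := by
      apply mul_right_cancel₀ hs
      linear_combination 2 * hp0 + s * hp1
    linear_combination this - e1
  refine ⟨z1 + z2 * xx F n + z3 * yy F n + z4 * (xx F n * yy F n), ?_⟩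
  simp only [map_add, map_mul, h1, h2, h3, h4, hx, hy]
  rw [← e1, ← e2, ← e3, ← e4]
  ext i j
  fin_cases i <;> fin_cases j <;>
    simp [Matrix.algebraMap_matrix_apply, Matrix.mul_apply] <;> ring

/-- Over `E` the columns `(1, γ)` and `(1, γ⁻¹)` are eigenvectors of the image of `x`, and the image
of `y` swaps them up to factors. As `f = f*` vanishes at both eigenvalues, vanishing there is the
same as divisibility by `f`. The parameter `c` is the square of the image of `y`: `1` for the
factors of `x^n - 1`, `-1` for those of `x^n + 1`. -/
theorem isBlock_self {E : Type*} [Field E] [Algebra F E] {γ : E}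
    (τ : GA F n →ₐ[F] Matrix (Fin 2) (Fin 2) F⟮γ + γ⁻¹⟯) (hγ : γ ≠ 0) (hγ' : γ ≠ γ⁻¹)
    {a b : F⟮γ + γ⁻¹⟯} {c : F} (hc : c ≠ 0)
    (habc : a ^ 2 + AdjoinSimple.gen F (γ + γ⁻¹) * a * b + b ^ 2 = algebraMap F _ c)
    (hx : τ (xx F n) = !![0, 1; -1, AdjoinSimple.gen F (γ + γ⁻¹)])
    (hy : τ (yy F n) = !![a, b; b + a * AdjoinSimple.gen F (γ + γ⁻¹), -a])
    {f : F[X]} (h0 : f.coeff 0 ≠ 0) (hm : f.Monic)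
    (hi : Irreducible f) (hf : aeval γ f = 0) (hself : recip f = f) :
    IsBlock τ f := by
  have hint : IsIntegral F γ := ⟨f, hm, hf⟩
  have hf' : aeval γ⁻¹ f = 0 := by
    have := (aeval_inv_recip h0 hγ).2 hf
    rwa [hself] at this
  have hdvd : ∀ P : F[X], f ∣ P ↔ aeval γ P = 0 ∧ aeval γ⁻¹ P = 0 := fun P =>
    ⟨fun h => ⟨(dvd_of_aeval_eq_zero hm hi hf).1 h, (dvd_of_aeval_eq_zero hm hi hf').1 h⟩,
      fun h => (dvd_of_aeval_eq_zero hm hi hf).2 h.1⟩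
  set m : F⟮γ + γ⁻¹⟯ →ₐ[F] E := F⟮γ + γ⁻¹⟯.val with hmdef
  have hsE : m (AdjoinSimple.gen F (γ + γ⁻¹)) = γ + γ⁻¹ := AdjoinSimple.coe_gen F _
  have habcE : m a ^ 2 + (γ + γ⁻¹) * m a * m b + m b ^ 2 = algebraMap F E c := by
    have := congrArg m habc
    simp only [map_add, map_mul, map_pow] at this
    rwa [hsE, m.commutes] at this
  have hs4 : AdjoinSimple.gen F (γ + γ⁻¹) ^ 2 - 4 ≠ 0 := by
    intro h
    have h' := congrArg m h
    rw [map_sub, map_pow, map_zero, map_ofNat, hsE] at h'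
    -- With `s = γ + γ⁻¹`, `s² - 4 = (γ - γ⁻¹)²`.
    have h3 : (γ - γ⁻¹) ^ 2 = 0 := by
      rw [← h']; field_simp; ring
    exact hγ' (sub_eq_zero.1 (pow_eq_zero_iff two_ne_zero |>.1 h3))
  refine ⟨surjective_of_companion τ hc habc hs4 hx hy
    (exists_aeval_gen (hint.add hint.inv)), fun P Q => ?_⟩
  rw [hdvd, hdvd]
  have hinj : Function.Injective (m.mapMatrix (m := Fin 2)) := fun A B h => by
    refine Matrix.ext fun i j => m.toRingHom.injective ?_
    exact congrFun (congrFun h i) j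
  -- These are the factors by which the image of `y` swaps the eigenvectors; their product is the
  -- quadratic form in `a, b`, that is `c`.
  have hκκ : (m a + m b * γ) * (m a + m b * γ⁻¹) ≠ 0 := by
    have : (m a + m b * γ) * (m a + m b * γ⁻¹) = algebraMap F E c := by
      rw [← habcE]; field_simp; ring
    rw [this]
    exact fun h => hc ((map_eq_zero _).1 h)
  have hV : IsUnit (!![1, 1; γ, γ⁻¹] : Matrix (Fin 2) (Fin 2) E) := by
    rw [Matrix.isUnit_iff_isUnit_det, Matrix.det_fin_two_of, isUnit_iff_ne_zero]
    intro h
    apply hγ'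
    linear_combination -h
  have key := map_eq_zero_iff_of_diag (m.mapMatrix.comp τ) hV (γ := γ) (γ' := γ⁻¹)
    (left_ne_zero_of_mul hκκ) (right_ne_zero_of_mul hκκ) ?_ ?_ P Q
  · rw [← key, AlgHom.comp_apply, map_eq_zero_iff _ hinj]
  · rw [AlgHom.comp_apply, hx]
    ext i j
    fin_cases i <;> fin_cases j <;>
      simp [hsE, Matrix.mul_apply, Fin.sum_univ_two] <;> field_simp <;> ring
  · rw [AlgHom.comp_apply, hy]
    ext i j
    fin_cases i <;> fin_cases j <;>
      simp [hsE, Matrix.mul_apply, Fin.sum_univ_two] <;> field_simp <;> ring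

end two

/-! ### Commutative blocks -/

section comm

variable {F : Type*} [Field F] {n : ℕ}

/-- Polynomials in `x` map to the diagonal of `F × F`, and the image of `y` lies in the
antidiagonal; these are complementary because `2` is invertible. -/
theorem isBlock_split (h2 : (2 : F) ≠ 0) (τ : GA F n →ₐ[F] F × F) {ε κ : F} (hκ : κ ≠ 0)
    (hx : τ (xx F n) = (ε, ε)) (hy : τ (yy F n) = (κ, -κ)) : IsBlock τ (X - C ε) := by
  have hP : ∀ P : F[X], τ (aeval (xx F n) P) = (P.eval ε, P.eval ε) := fun P => by
    rw [← aeval_algHom_apply, hx]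
    exact aeval_algebraMap_apply (F × F) ε P
  refine ⟨fun z => ?_, fun P Q => ?_⟩
  · refine ⟨algebraMap F _ ((z.1 + z.2) / 2) + ((z.1 - z.2) / (2 * κ)) • yy F n, ?_⟩
    rw [map_add, map_smul, hy, AlgHom.commutes]
    ext
    · simp; field_simp; ring
    · simp; field_simp; ring
  · rw [map_add, map_mul, hP, hP, hy, dvd_iff_isRoot, dvd_iff_isRoot, IsRoot, IsRoot,
      Prod.ext_iff]
    simp only [Prod.fst_add, Prod.snd_add, Prod.fst_mul, Prod.snd_mul, Prod.fst_zero,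
      Prod.snd_zero]
    constructor
    · rintro ⟨h, h'⟩
      have h3 : P.eval ε = 0 := by
        apply mul_left_cancel₀ h2
        linear_combination h + h'
      rw [h3, zero_add, mul_eq_zero] at h
      exact ⟨h3, h.resolve_left hκ⟩
    · rintro ⟨h, h'⟩
      rw [h, h']
      simp

/-- The image of `P(x) + y Q(x)` is the class of `P(-1) + Q(-1) T`, which has degree below that of
`T² + 1`. Irreducibility of `T² + 1` plays no role here. -/
theorem isBlock_adjoinRoot (τ : GA F n →ₐ[F] AdjoinRoot (X ^ 2 + 1 : F[X]))
    (hx : τ (xx F n) = -1) (hy : τ (yy F n) = AdjoinRoot.root (X ^ 2 + 1 : F[X])) :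
    IsBlock τ (X + 1) := by
  have hP : ∀ P : F[X], τ (aeval (xx F n) P) = algebraMap F _ (P.eval (-1)) := fun P => by
    rw [← aeval_algHom_apply, hx, ← aeval_algebraMap_apply_eq_algebraMap_eval, map_neg, map_one]
  have hX : (X + 1 : F[X]) = X - C (-1) := by simp
  refine ⟨fun z => ?_, fun P Q => ?_⟩
  · obtain ⟨P, rfl⟩ := AdjoinRoot.mk_surjective z
    exact ⟨aeval (yy F n) P, by rw [← aeval_algHom_apply, hy, AdjoinRoot.aeval_eq]⟩
  · rw [map_add, map_mul, hP, hP, hy, hX, dvd_iff_isRoot, dvd_iff_isRoot, IsRoot, IsRoot]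
    have hmk : algebraMap F (AdjoinRoot (X ^ 2 + 1 : F[X])) (eval (-1) P)
        + AdjoinRoot.root (X ^ 2 + 1 : F[X]) * algebraMap F _ (eval (-1) Q)
        = AdjoinRoot.mk _ (C (eval (-1) Q) * X + C (eval (-1) P)) := by
      rw [map_add, map_mul, AdjoinRoot.mk_X, AdjoinRoot.mk_C, AdjoinRoot.mk_C,
        ← AdjoinRoot.algebraMap_eq]
      ring
    rw [hmk, AdjoinRoot.mk_eq_zero]
    constructor
    · intro h
      have hdeg : (X ^ 2 + 1 : F[X]).degree = 2 := by compute_degree!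
      have h0 := eq_zero_of_dvd_of_degree_lt h
        (lt_of_le_of_lt degree_linear_le (by rw [hdeg]; exact Nat.one_lt_ofNat))
      have e0 := congrArg (coeff · 0) h0
      have e1 := congrArg (coeff · 1) h0
      simp at e0 e1
      exact ⟨e0, e1⟩
    · rintro ⟨h, h'⟩
      simp [h, h']

end comm

/-! ### Surjectivity onto sums of blocks -/

section sum

variable {F : Type*} [Field F] {G A B : Type*} [Ring G] [Algebra F G] [Ring A] [Algebra F A]
  [Ring B] [Algebra F B]

/-- A surjective homomorphism whose kernel contains `p(x)` for a polynomial `p` that is coprime to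
everything that is coprime to the polynomials in `S`. -/
structure IsSurjSum (x : G) (φ : G →ₐ[F] A) (S : Set F[X]) : Prop where
  surjective : Function.Surjective φ
  exists_poly : ∃ p : F[X], φ (aeval x p) = 0 ∧ ∀ q, (∀ s ∈ S, IsCoprime s q) → IsCoprime p q

theorem exists_idem_of_isCoprime {x : G} {φ : G →ₐ[F] A} {ψ : G →ₐ[F] B} {p q : F[X]}
    (hp : φ (aeval x p) = 0) (hq : ψ (aeval x q) = 0) (h : IsCoprime p q) :
    ∃ e : G, φ e = 1 ∧ ψ e = 0 := by
  obtain ⟨a, b, hab⟩ := h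
  have h1 := congrArg (fun P => φ (aeval x P)) hab
  simp only [map_add, map_mul, hp, mul_zero, zero_add, map_one] at h1
  exact ⟨aeval x (b * q), by simpa using h1, by simp [hq]⟩

/-- Chinese remaindering in a noncommutative ring: Bézout for the two killing polynomials in `x`
gives an element mapping to `(1, 0)`, with which preimages are glued. The product of these
polynomials kills the combined image, so the construction can be iterated. -/
theorem IsSurjSum.prod {x : G} {φ : G →ₐ[F] A} {ψ : G →ₐ[F] B} {S T : Set F[X]}
    (hφ : IsSurjSum x φ S) (hψ : IsSurjSum x ψ T) (h : ∀ s ∈ S, ∀ t ∈ T, IsCoprime s t) :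
    IsSurjSum x (φ.prod ψ) (S ∪ T) := by
  obtain ⟨p, hp, hp'⟩ := hφ.exists_poly
  obtain ⟨q, hq, hq'⟩ := hψ.exists_poly
  have hpq : IsCoprime p q := hp' _ fun s hs => (hq' _ fun t ht => (h s hs t ht).symm).symm
  refine ⟨fun z => ?_, p * q, ?_, fun c hc => ?_⟩
  · obtain ⟨e, h1, h2⟩ := exists_idem_of_isCoprime hp hq hpq
    obtain ⟨a, ha⟩ := hφ.surjective z.1
    obtain ⟨b, hb⟩ := hψ.surjective z.2
    refine ⟨a * e + b * (1 - e), Prod.ext ?_ ?_⟩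
    · simp [h1, ha]
    · simp [h2, hb]
  · exact Prod.ext (by simp [hp]) (by simp [hq])
  · exact (hp' c fun s hs => hc s (Or.inl hs)).mul_left (hq' c fun t ht => hc t (Or.inr ht))

theorem IsSurjSum.pi {ι : Type*} [Finite ι] {A : ι → Type*} [∀ i, Ring (A i)]
    [∀ i, Algebra F (A i)] {x : G} {φ : ∀ i, G →ₐ[F] A i} {p : ι → F[X]}
    (hφ : ∀ i, Function.Surjective (φ i)) (hp : ∀ i, φ i (aeval x (p i)) = 0)
    (h : Pairwise fun i j => IsCoprime (p i) (p j)) :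
    IsSurjSum x (AlgHom.pi φ) (Set.range p) := by
  classical
  have := Fintype.ofFinite ι
  refine ⟨fun z => ?_, ∏ i, p i, ?_, fun c hc => ?_⟩
  · have he : ∀ i, ∃ e : G, φ i e = 1 ∧ ∀ j ≠ i, φ j e = 0 := fun i => by
      have hco : IsCoprime (p i) (∏ j ∈ Finset.univ.erase i, p j) :=
        IsCoprime.prod_right fun j hj => h (Finset.ne_of_mem_erase hj).symm
      obtain ⟨a, b, hab⟩ := hco
      have h1 := congrArg (fun P => φ i (aeval x P)) hab
      simp only [map_add, map_mul, hp, mul_zero, zero_add, map_one] at h1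
      refine ⟨aeval x (b * ∏ j ∈ Finset.univ.erase i, p j), by simpa using h1, fun j hj => ?_⟩
      rw [← Finset.mul_prod_erase (Finset.univ.erase i) p
        (Finset.mem_erase.2 ⟨hj, Finset.mem_univ j⟩), mul_left_comm, map_mul, map_mul, hp, zero_mul]
    choose e he1 he0 using he
    choose w hw using fun i => hφ i (z i)
    refine ⟨∑ i, w i * e i, funext fun j => ?_⟩
    rw [AlgHom.pi_apply, map_sum, Finset.sum_eq_single j, map_mul, he1, mul_one, hw]
    · intro i _ hij
      rw [map_mul, he0 i j hij.symm, mul_zero]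
    · simp
  · funext j
    rw [AlgHom.pi_apply, ← Finset.mul_prod_erase _ p (Finset.mem_univ j), map_mul, map_mul, hp,
      zero_mul, Pi.zero_apply]
  · exact IsCoprime.prod_left fun i _ => hc _ ⟨i, rfl⟩

end sum

/-! ### The polynomials of the blocks -/

section factors

variable {F : Type*} [Field F]

/-- The block polynomial: `f_j` for a self-reciprocal factor, `f_j f_j*` for a pair. -/
noncomputable def blockPoly (r : ℕ) (f : ℕ → F[X]) (j : ℕ) : F[X] :=
  if j ≤ r then f j else f j * recip (f j)

theorem prod_blockPoly (r s : ℕ) (f : ℕ → F[X]) :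
    (∏ j ∈ Finset.Icc 1 r, f j) * ∏ j ∈ Finset.Ioc r (r + s), (f j * recip (f j))
      = ∏ j ∈ Finset.Icc 1 (r + s), blockPoly r f j := by
  have h1 : ∀ m, Finset.Icc 1 m = Finset.Ioc 0 m := fun m => by ext; simp; omega
  rw [h1, h1, ← Finset.prod_Ioc_consecutive _ (Nat.zero_le r) (Nat.le_add_right r s)]
  congr 1
  · refine Finset.prod_congr rfl fun j hj => ?_
    rw [blockPoly, if_pos (Finset.mem_Ioc.1 hj).2]
  · refine Finset.prod_congr rfl fun j hj => ?_
    rw [blockPoly, if_neg (not_le.2 (Finset.mem_Ioc.1 hj).1)]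

theorem isCoprime_of_squarefree_prod {t : Finset ℕ} {p : ℕ → F[X]}
    (h : Squarefree (∏ j ∈ t, p j)) {i j : ℕ} (hi : i ∈ t) (hj : j ∈ t) (hij : i ≠ j) :
    IsCoprime (p i) (p j) := by
  rw [← Finset.mul_prod_erase t p hi,
    ← Finset.mul_prod_erase (t.erase i) p (Finset.mem_erase.2 ⟨hij.symm, hj⟩), ← mul_assoc] at h
  exact (squarefree_mul_iff.1 h.of_mul_left).1.isCoprime

variable {n : ℕ}

theorem coeff_zero_ne_zero_of_dvd {p q : F[X]} (h : p ∣ q) (hq : q.coeff 0 ≠ 0) :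
    p.coeff 0 ≠ 0 := by
  obtain ⟨c, rfl⟩ := h
  rw [mul_coeff_zero] at hq
  exact left_ne_zero_of_mul hq

/-- A linear factor `X - c` with `c = c⁻¹` divides a self-reciprocal block only. -/
theorem exists_le_of_root {r s : ℕ} {f : ℕ → F[X]} {q : F[X]}
    (hq : q = ∏ j ∈ Finset.Icc 1 (r + s), blockPoly r f j) (hs : Squarefree q)
    (h0 : q.coeff 0 ≠ 0)
    (hm : ∀ j ∈ Finset.Icc 1 (r + s), (f j).Monic)
    (hi : ∀ j ∈ Finset.Icc 1 (r + s), Irreducible (f j)) {c : F} (hc : c⁻¹ = c) (hc0 : c ≠ 0)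
    (hroot : q.eval c = 0) : ∃ j ∈ Finset.Icc 1 r, f j = X - C c := by
  have hroot' := hroot
  rw [hq, eval_prod, Finset.prod_eq_zero_iff] at hroot'
  obtain ⟨j, hj, hjc⟩ := hroot'
  have hjm := Finset.mem_Icc.1 hj
  have hd : blockPoly r f j ∣ q := hq ▸ Finset.dvd_prod_of_mem _ hj
  have hX : ∀ p : F[X], p.eval c = 0 → X - C c ∣ p := fun p hp => dvd_iff_isRoot.2 hp
  by_cases hjr : j ≤ r
  · rw [blockPoly, if_pos hjr] at hjc
    refine ⟨j, Finset.mem_Icc.2 ⟨hjm.1, hjr⟩, eq_X_sub_C (E := F) (hm j hj) (hi j hj) ?_⟩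
    simpa [aeval_def] using hjc
  · exfalso
    rw [blockPoly, if_neg hjr] at hjc hd
    have hf0 : (f j).coeff 0 ≠ 0 := coeff_zero_ne_zero_of_dvd (dvd_of_mul_right_dvd hd) h0
    have hiff : (recip (f j)).eval c = 0 ↔ (f j).eval c = 0 := by
      have := aeval_recip (E := F) hf0 hc0
      simpa [aeval_def, hc] using this
    rw [eval_mul, mul_eq_zero, hiff, or_self] at hjc
    -- As `c = c⁻¹`, the number `c` is a root of both `f_j` and `f_j*`, so `(X - c)²` would divide
    -- the squarefree `q`.
    refine (irreducible_X_sub_C c).not_isUnit (hs _ ((mul_dvd_mul (hX _ hjc) (hX _ ?_)).trans hd))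
    exact hiff.2 hjc

end factors

/-! ### The blocks of a labelled factorization -/

section factorization

variable {F : Type*} [Field F] {n : ℕ}

theorem IsBlock.map_poly_eq_zero {A : Type*} [Ring A] [Algebra F A] {τ : GA F n →ₐ[F] A}
    {p : F[X]} (h : IsBlock τ p) : τ (aeval (xx F n) p) = 0 :=
  (h.map_aeval_eq_zero_iff p).2 dvd_rfl

variable (D : Factorization F n)

theorem X_pow_sub_one_eq_prod :
    (X ^ n - 1 : F[X]) = ∏ j ∈ Finset.Icc 1 (D.r + D.s), blockPoly D.r D.f j := by
  rw [D.f_prod, prod_blockPoly]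

theorem X_pow_add_one_eq_prod :
    (X ^ n + 1 : F[X]) = ∏ i ∈ Finset.Icc 1 (D.t + D.k), blockPoly D.t D.g i := by
  rw [D.g_prod, prod_blockPoly]

theorem X_pow_two_mul_sub_one (n : ℕ) :
    (X ^ (2 * n) - 1 : F[X]) = (X ^ n - 1) * (X ^ n + 1) := by
  rw [two_mul, pow_add]; ring

theorem mod_four_of_coprime {q : ℕ} (hq : (4 * n).Coprime q) : q % 4 = 1 ∨ q % 4 = 3 := by
  have : Nat.Coprime 2 q := Nat.Coprime.coprime_dvd_left ⟨2 * n, by ring⟩ hq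
  have := (Nat.coprime_two_left.1 this)
  rcases this with ⟨m, hm⟩
  omega

theorem mem_of_self (j : Set.Ioc (delta n) D.r) : j.1 ∈ Finset.Icc 1 (D.r + D.s) := by
  have := j.2.1; have := j.2.2; simp; omega

theorem mem_of_pair (j : Set.Ioc D.r (D.r + D.s)) : j.1 ∈ Finset.Icc 1 (D.r + D.s) := by
  have := j.2.1; have := j.2.2; simp; omega

theorem mem_of_self' (i : Set.Ioc (mu n) D.t) : i.1 ∈ Finset.Icc 1 (D.t + D.k) := by
  have := i.2.1; have := i.2.2; simp; omega

theorem mem_of_pair' (i : Set.Ioc D.t (D.t + D.k)) : i.1 ∈ Finset.Icc 1 (D.t + D.k) := by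
  have := i.2.1; have := i.2.2; simp; omega

theorem g_eq_of_le_mu {i : ℕ} (hi : i ∈ Set.Icc 1 (mu n)) : D.g i = X + 1 := by
  have h1 := hi.1
  have h2 := hi.2
  have h3 : mu n = 1 := by simp [mu, Nat.not_even_iff_odd.2 (odd_of_mem hi)]
  rw [show i = 1 by omega, D.g_one (odd_of_mem hi)]

theorem aeval_gen_eq_zero {E : Type*} [Field E] [Algebra F E] {γ : E} {f : F[X]} (h : aeval γ f = 0) :
    aeval (AdjoinSimple.gen F γ) f = 0 := by
  apply F⟮γ⟯.val.toRingHom.injective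
  rw [map_zero, ← h]
  exact (aeval_algHom_apply F⟮γ⟯.val (AdjoinSimple.gen F γ) f).symm

theorem gen_ne_zero {E : Type*} [Field E] [Algebra F E] {γ : E} (h : γ ≠ 0) : AdjoinSimple.gen F γ ≠ 0 := fun h0 =>
  h (by simpa using congrArg Subtype.val h0)

theorem fBlock_dvd {j : ℕ} (hj : j ∈ Finset.Icc 1 (D.r + D.s)) :
    blockPoly D.r D.f j ∣ X ^ n - 1 :=
  X_pow_sub_one_eq_prod D ▸ Finset.dvd_prod_of_mem _ hj

theorem gBlock_dvd {i : ℕ} (hi : i ∈ Finset.Icc 1 (D.t + D.k)) :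
    blockPoly D.t D.g i ∣ X ^ n + 1 :=
  X_pow_add_one_eq_prod D ▸ Finset.dvd_prod_of_mem _ hi

theorem fBlock_dvd_two_mul {j : ℕ} (hj : j ∈ Finset.Icc 1 (D.r + D.s)) :
    blockPoly D.r D.f j ∣ X ^ (2 * n) - 1 :=
  (fBlock_dvd D hj).trans (X_pow_two_mul_sub_one (F := F) n ▸ dvd_mul_right _ _)

theorem gBlock_dvd_two_mul {i : ℕ} (hi : i ∈ Finset.Icc 1 (D.t + D.k)) :
    blockPoly D.t D.g i ∣ X ^ (2 * n) - 1 :=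
  (gBlock_dvd D hi).trans (X_pow_two_mul_sub_one (F := F) n ▸ dvd_mul_left _ _)

variable [Finite F]

theorem squarefree_X_pow_sub_one (hq : (4 * n).Coprime (Nat.card F)) :
    Squarefree (X ^ n - 1 : F[X]) :=
  ((X_pow_sub_one_separable_iff).2 (natCast_ne_zero_of_coprime hq)).squarefree

theorem squarefree_X_pow_add_one (hq : (4 * n).Coprime (Nat.card F)) :
    Squarefree (X ^ n + 1 : F[X]) := by
  simpa using (separable_X_pow_sub_C (-1 : F) (natCast_ne_zero_of_coprime hq)
    (by simp)).squarefree

theorem isCoprime_X_pow_sub_one_add_one (hq : (4 * n).Coprime (Nat.card F)) :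
    IsCoprime (X ^ n - 1 : F[X]) (X ^ n + 1) := by
  have h : (C (2 : F)⁻¹ : F[X]) * 2 = 1 := by
    rw [← C_ofNat, ← C_mul, inv_mul_cancel₀ (two_ne_zero_of_coprime hq), C_1]
  exact ⟨-C 2⁻¹, C 2⁻¹, by linear_combination h⟩

theorem coeff_zero_X_pow_sub_one (hq : (4 * n).Coprime (Nat.card F)) :
    (X ^ n - 1 : F[X]).coeff 0 ≠ 0 := by
  simp [coeff_X_pow, (ne_zero_of_coprime hq).symm]

theorem coeff_zero_X_pow_add_one (hq : (4 * n).Coprime (Nat.card F)) :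
    (X ^ n + 1 : F[X]).coeff 0 ≠ 0 := by
  simp [coeff_X_pow, (ne_zero_of_coprime hq).symm]

theorem f_coeff_zero_ne_zero (hq : (4 * n).Coprime (Nat.card F)) {j : ℕ}
    (hj : j ∈ Finset.Icc 1 (D.r + D.s)) : (D.f j).coeff 0 ≠ 0 :=
  coeff_zero_ne_zero_of_dvd (f_dvd D hj) (coeff_zero_X_pow_sub_one hq)

theorem g_coeff_zero_ne_zero (hq : (4 * n).Coprime (Nat.card F)) {j : ℕ}
    (hj : j ∈ Finset.Icc 1 (D.t + D.k)) : (D.g j).coeff 0 ≠ 0 :=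
  coeff_zero_ne_zero_of_dvd (g_dvd D hj) (coeff_zero_X_pow_add_one hq)

theorem isCoprime_fBlock (hq : (4 * n).Coprime (Nat.card F)) {i j : ℕ}
    (hi : i ∈ Finset.Icc 1 (D.r + D.s)) (hj : j ∈ Finset.Icc 1 (D.r + D.s)) (hij : i ≠ j) :
    IsCoprime (blockPoly D.r D.f i) (blockPoly D.r D.f j) :=
  isCoprime_of_squarefree_prod (X_pow_sub_one_eq_prod D ▸ squarefree_X_pow_sub_one hq) hi hj hij

theorem isCoprime_gBlock (hq : (4 * n).Coprime (Nat.card F)) {i j : ℕ}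
    (hi : i ∈ Finset.Icc 1 (D.t + D.k)) (hj : j ∈ Finset.Icc 1 (D.t + D.k)) (hij : i ≠ j) :
    IsCoprime (blockPoly D.t D.g i) (blockPoly D.t D.g j) :=
  isCoprime_of_squarefree_prod (X_pow_add_one_eq_prod D ▸ squarefree_X_pow_add_one hq) hi hj hij

theorem isCoprime_fBlock_gBlock (hq : (4 * n).Coprime (Nat.card F)) {j i : ℕ}
    (hj : j ∈ Finset.Icc 1 (D.r + D.s)) (hi : i ∈ Finset.Icc 1 (D.t + D.k)) :
    IsCoprime (blockPoly D.r D.f j) (blockPoly D.t D.g i) :=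
  ((isCoprime_X_pow_sub_one_add_one hq).of_isCoprime_of_dvd_left (fBlock_dvd D hj)
    ).of_isCoprime_of_dvd_right (gBlock_dvd D hi)

theorem X_pow_sub_one_dvd_of_blocks (hq : (4 * n).Coprime (Nat.card F)) {P : F[X]}
    (hf : ∀ j ∈ Finset.Icc 1 (D.r + D.s), blockPoly D.r D.f j ∣ P)
    (hg : ∀ i ∈ Finset.Icc 1 (D.t + D.k), blockPoly D.t D.g i ∣ P) :
    X ^ (2 * n) - 1 ∣ P := by
  rw [X_pow_two_mul_sub_one]
  refine (isCoprime_X_pow_sub_one_add_one hq).mul_dvd ?_ ?_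
  · rw [X_pow_sub_one_eq_prod D]
    exact Finset.prod_dvd_of_coprime
      (fun i hi j hj hij => isCoprime_fBlock D hq hi hj hij) hf
  · rw [X_pow_add_one_eq_prod D]
    exact Finset.prod_dvd_of_coprime
      (fun i hi j hj hij => isCoprime_gBlock D hq hi hj hij) hg

theorem one_ne_neg_one (hq : (4 * n).Coprime (Nat.card F)) : (1 : F) ≠ -1 := fun h =>
  two_ne_zero_of_coprime hq (by linear_combination h)

/-- The labelling prescribes `f_1` and `f_2` but not that these labels lie among the first `r`. The
roots `1` and, for even `n`, `-1` equal their inverses, so they belong to distinct self-reciprocal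
factors, whose number `r` is then at least `δ(n)`. -/
theorem delta_le (hq : (4 * n).Coprime (Nat.card F)) : delta n ≤ D.r := by
  obtain ⟨j, hj, hj1⟩ := exists_le_of_root (X_pow_sub_one_eq_prod D) (squarefree_X_pow_sub_one hq)
    (coeff_zero_X_pow_sub_one hq) D.f_monic D.f_irreducible (c := 1) inv_one one_ne_zero (by simp)
  have hj' := Finset.mem_Icc.1 hj
  by_cases hev : Even n
  · obtain ⟨i, hi, hi1⟩ := exists_le_of_root (X_pow_sub_one_eq_prod D)
      (squarefree_X_pow_sub_one hq) (coeff_zero_X_pow_sub_one hq) D.f_monic D.f_irreducible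
      (c := -1) (by rw [inv_neg, inv_one]) (by simp) (by simp [hev.neg_one_pow])
    have hi' := Finset.mem_Icc.1 hi
    have hij : i ≠ j := by
      rintro rfl
      rw [hj1] at hi1
      exact one_ne_neg_one hq (C_injective (sub_right_injective hi1))
    rw [delta, if_pos hev]
    omega
  · rw [delta, if_neg hev]
    omega

theorem mu_le (hq : (4 * n).Coprime (Nat.card F)) : mu n ≤ D.t := by
  by_cases hev : Even n
  · simp [mu, hev]
  · obtain ⟨j, hj, -⟩ := exists_le_of_root (X_pow_add_one_eq_prod D)
      (squarefree_X_pow_add_one hq) (coeff_zero_X_pow_add_one hq) D.g_monic D.g_irreducible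
      (c := -1) (by rw [inv_neg, inv_one]) (by simp)
      (by simp [(Nat.not_even_iff_odd.1 hev).neg_one_pow])
    rw [mu, if_neg hev]
    exact (Finset.mem_Icc.1 hj).1.trans (Finset.mem_Icc.1 hj).2

theorem mem_of_lin (hq : (4 * n).Coprime (Nat.card F)) (j : Set.Icc 1 (delta n)) :
    j.1 ∈ Finset.Icc 1 (D.r + D.s) := by
  have := j.2.1; have := j.2.2; have := delta_le D hq; simp; omega

theorem mem_of_le_mu (hq : (4 * n).Coprime (Nat.card F)) {i : ℕ} (hi : i ∈ Set.Icc 1 (mu n)) :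
    i ∈ Finset.Icc 1 (D.t + D.k) := by
  have := hi.1; have := hi.2; have := mu_le D hq; simp; omega

theorem fBlock_lin (hq : (4 * n).Coprime (Nat.card F)) (j : Set.Icc 1 (delta n)) :
    blockPoly D.r D.f j = D.f j := by
  rw [blockPoly, if_pos (j.2.2.trans (delta_le D hq))]

theorem gBlock_le_mu (hq : (4 * n).Coprime (Nat.card F)) {i : ℕ} (hi : i ∈ Set.Icc 1 (mu n)) :
    blockPoly D.t D.g i = D.g i := by
  rw [blockPoly, if_pos (hi.2.trans (mu_le D hq))]

theorem isCoprime_f_recip (hq : (4 * n).Coprime (Nat.card F)) (j : Set.Ioc D.r (D.r + D.s)) :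
    IsCoprime (D.f j) (recip (D.f j)) := by
  have h := (squarefree_X_pow_sub_one hq).squarefree_of_dvd (fBlock_dvd D (mem_of_pair D j))
  rw [blockPoly, if_neg (not_le.2 j.2.1)] at h
  exact (squarefree_mul_iff.1 h).1.isCoprime

theorem isCoprime_g_recip (hq : (4 * n).Coprime (Nat.card F)) (i : Set.Ioc D.t (D.t + D.k)) :
    IsCoprime (D.g i) (recip (D.g i)) := by
  have h := (squarefree_X_pow_add_one hq).squarefree_of_dvd (gBlock_dvd D (mem_of_pair' D i))
  rw [blockPoly, if_neg (not_le.2 i.2.1)] at h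
  exact (squarefree_mul_iff.1 h).1.isCoprime

end factorization

/-! ### The components of the realization as blocks -/

section isBlock

variable {F : Type*} [Field F] [Finite F] {n : ℕ} {D : Factorization F n}
  {E : Type*} [Field E] [Algebra F E] (hq : (4 * n).Coprime (Nat.card F)) (R : RootData D E)

theorem tauLin_yy (j : Set.Icc 1 (delta n)) : tauLin hq j (yy F n) = (1, -1) := by
  simp only [tauLin, algLift_yy]

theorem tauPair_xx (j : Set.Ioc D.r (D.r + D.s)) : tauPair hq R j (xx F n) =
    !![AdjoinSimple.gen F (R.α j), 0; 0, (AdjoinSimple.gen F (R.α j))⁻¹] := by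
  simp only [tauPair, algLift_xx]

theorem tauPair_yy (j : Set.Ioc D.r (D.r + D.s)) : tauPair hq R j (yy F n) = !![0, 1; 1, 0] := by
  simp only [tauPair, algLift_yy]

theorem etaSplit_yy (i : {i : ℕ // i ∈ Set.Icc 1 (mu n) ∧ Nat.card F % 4 = 1}) :
    etaSplit hq R i (yy F n) = (R.ι, -R.ι) := by
  simp only [etaSplit, algLift_yy]

theorem etaPair_xx (i : Set.Ioc D.t (D.t + D.k)) : etaPair hq R i (xx F n) =
    !![AdjoinSimple.gen F (R.β i), 0; 0, (AdjoinSimple.gen F (R.β i))⁻¹] := by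
  simp only [etaPair, algLift_xx]

theorem etaPair_yy (i : Set.Ioc D.t (D.t + D.k)) : etaPair hq R i (yy F n) = !![0, 1; -1, 0] := by
  simp only [etaPair, algLift_yy]

theorem isBlock_tauLin (D : Factorization F n) (j : Set.Icc 1 (delta n)) :
    IsBlock (tauLin hq j) (blockPoly D.r D.f j) := by
  obtain ⟨ε, hε, hf⟩ : ∃ ε : F, tauLin hq j (xx F n) = (ε, ε) ∧ D.f j = X - C ε := by
    have h : tauLin hq j (xx F n) = if j.1 = 1 then 1 else -1 := by
      simp only [tauLin, algLift_xx]
    by_cases h1 : j.1 = 1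
    · exact ⟨1, by rw [h, if_pos h1]; rfl, by rw [h1, D.f_one, C_1]⟩
    · have hev := even_of_mem j.2 h1
      have h2 : delta n = 2 := by simp [delta, hev]
      have h3 : j.1 = 2 := by have := j.2.1; have := j.2.2; omega
      exact ⟨-1, by rw [h, if_neg h1]; rfl, by rw [h3, D.f_two hev]; simp⟩
  rw [fBlock_lin D hq j, hf]
  exact isBlock_split (two_ne_zero_of_coprime hq) _ one_ne_zero hε (tauLin_yy hq j)

theorem isBlock_etaSplit (i : {i : ℕ // i ∈ Set.Icc 1 (mu n) ∧ Nat.card F % 4 = 1}) :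
    IsBlock (etaSplit hq R i) (blockPoly D.t D.g i) := by
  rw [gBlock_le_mu D hq i.2.1, g_eq_of_le_mu D i.2.1,
    show (X + 1 : F[X]) = X - C (-1) by simp]
  have hι : R.ι ≠ 0 := fun h => by simpa [h] using R.ι_sq i.2.2
  have hx : etaSplit hq R i (xx F n) = -1 := by simp only [etaSplit, algLift_xx]
  exact isBlock_split (two_ne_zero_of_coprime hq) _ hι hx (etaSplit_yy hq R i)

theorem isBlock_etaField (D : Factorization F n)
    (i : {i : ℕ // i ∈ Set.Icc 1 (mu n) ∧ Nat.card F % 4 = 3}) :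
    IsBlock (etaField hq i) (blockPoly D.t D.g i) := by
  rw [gBlock_le_mu D hq i.2.1, g_eq_of_le_mu D i.2.1]
  exact isBlock_adjoinRoot _ (by simp only [etaField, algLift_xx])
    (by simp only [etaField, algLift_yy])

theorem isBlock_tauSelf (j : Set.Ioc (delta n) D.r) :
    IsBlock (tauSelf hq R j) (blockPoly D.r D.f j) := by
  have hm := mem_of_self D j
  have hj : j.1 ∈ Finset.Icc 1 D.r := by have := j.2.1; have := j.2.2; simp; omega
  rw [blockPoly, if_pos j.2.2]
  have hx : tauSelf hq R j (xx F n) = !![0, 1; -1, AdjoinSimple.gen F (R.α j + (R.α j)⁻¹)] := by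
    simp only [tauSelf, algLift_xx]
  have hy : tauSelf hq R j (yy F n) = !![1, -AdjoinSimple.gen F (R.α j + (R.α j)⁻¹); 0, -1] := by
    simp only [tauSelf, algLift_yy]
  -- The matrix of `y` is the general one with `a = 1`, `b = -σ`: then `b + a σ = 0` and `a² + σ a b
  -- + b² = 1`.
  refine isBlock_self _ (α_ne_zero hq R hm) (α_sq_ne hq R j.2) (a := 1)
    (b := -AdjoinSimple.gen F (R.α j + (R.α j)⁻¹)) (c := 1) one_ne_zero ?_ hx ?_
    (f_coeff_zero_ne_zero D hq hm) (D.f_monic j hm) (D.f_irreducible j hm) (R.α_root j hm)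
    (D.f_self j hj)
  · rw [map_one]; ring
  · rw [hy, one_mul, neg_add_cancel]

theorem isBlock_etaSelf (i : Set.Ioc (mu n) D.t) :
    IsBlock (etaSelf hq R i) (blockPoly D.t D.g i) := by
  have hm := mem_of_self' D i
  have hi : i.1 ∈ Finset.Icc 1 D.t := by have := i.2.1; have := i.2.2; simp; omega
  have hi' : i.1 ∈ Finset.Ioc (mu n) D.t := by have := i.2.1; have := i.2.2; simp; omega
  rw [blockPoly, if_pos i.2.2]
  refine isBlock_self _ (β_ne_zero hq R hm) (β_sq_ne hq R i.2) (a := R.a i)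
    (b := R.b i) (c := -1) (by simp) ?_
    (by simp only [etaSelf, algLift_xx]) (by simp only [etaSelf, algLift_yy])
    (g_coeff_zero_ne_zero D hq hm) (D.g_monic i hm) (D.g_irreducible i hm) (R.β_root i hm)
    (D.g_self i hi)
  rw [R.ab_eq i hi', map_neg, map_one]

theorem isBlock_tauPair (j : Set.Ioc D.r (D.r + D.s)) :
    IsBlock (tauPair hq R j) (blockPoly D.r D.f j) := by
  have hm := mem_of_pair D j
  rw [blockPoly, if_neg (not_le.2 j.2.1)]
  exact isBlock_pair _ (gen_ne_zero (α_ne_zero hq R hm)) one_ne_zero (tauPair_xx hq R j)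
    (tauPair_yy hq R j) (exists_aeval_gen ⟨_, D.f_monic j hm, R.α_root j hm⟩)
    (f_coeff_zero_ne_zero D hq hm) (D.f_monic j hm) (D.f_irreducible j hm)
    (aeval_gen_eq_zero (R.α_root j hm)) (isCoprime_f_recip D hq j)

theorem isBlock_etaPair (i : Set.Ioc D.t (D.t + D.k)) :
    IsBlock (etaPair hq R i) (blockPoly D.t D.g i) := by
  have hm := mem_of_pair' D i
  rw [blockPoly, if_neg (not_le.2 i.2.1)]
  exact isBlock_pair _ (gen_ne_zero (β_ne_zero hq R hm)) (neg_ne_zero.2 one_ne_zero)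
    (etaPair_xx hq R i)
    (etaPair_yy hq R i) (exists_aeval_gen ⟨_, D.g_monic i hm, R.β_root i hm⟩)
    (g_coeff_zero_ne_zero D hq hm) (D.g_monic i hm) (D.g_irreducible i hm)
    (aeval_gen_eq_zero (R.β_root i hm)) (isCoprime_g_recip D hq i)

/-! ### The realization is an isomorphism -/

/-- Each component forces its own block polynomial to divide `P` and `Q`; coprimality multiplies
these up to `x^(2n) - 1`. This gives injectivity of `ρ` and also uniqueness of the form `P(x) + y
Q(x)`. -/
theorem dvd_of_rho_eq_zero {P Q : F[X]}
    (h : rho hq R (aeval (xx F n) P + yy F n * aeval (xx F n) Q) = 0) :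
    X ^ (2 * n) - 1 ∣ P ∧ X ^ (2 * n) - 1 ∣ Q := by
  have hf : ∀ j ∈ Finset.Icc 1 (D.r + D.s),
      blockPoly D.r D.f j ∣ P ∧ blockPoly D.r D.f j ∣ Q := fun j hj => by
    have hj' := Finset.mem_Icc.1 hj
    rcases le_or_gt j (delta n) with h1 | h1
    · exact ((isBlock_tauLin hq D ⟨j, hj'.1, h1⟩).map_eq_zero_iff P Q).1
        (congrFun (congrArg (fun z => z.1.1) h) _)
    rcases le_or_gt j D.r with h2 | h2
    · exact ((isBlock_tauSelf hq R ⟨j, h1, h2⟩).map_eq_zero_iff P Q).1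
        (congrFun (congrArg (fun z => z.1.2.1) h) _)
    · exact ((isBlock_tauPair hq R ⟨j, h2, hj'.2⟩).map_eq_zero_iff P Q).1
        (congrFun (congrArg (fun z => z.1.2.2) h) _)
  have hg : ∀ j ∈ Finset.Icc 1 (D.t + D.k),
      blockPoly D.t D.g j ∣ P ∧ blockPoly D.t D.g j ∣ Q := fun j hj => by
    have hj' := Finset.mem_Icc.1 hj
    rcases le_or_gt j (mu n) with h1 | h1
    · rcases mod_four_of_coprime hq with h4 | h4
      · exact ((isBlock_etaSplit hq R ⟨j, ⟨hj'.1, h1⟩, h4⟩).map_eq_zero_iff P Q).1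
          (congrFun (congrArg (fun z => z.2.1) h) ⟨j, ⟨hj'.1, h1⟩, h4⟩)
      · exact ((isBlock_etaField hq D ⟨j, ⟨hj'.1, h1⟩, h4⟩).map_eq_zero_iff P Q).1
          (congrFun (congrArg (fun z => z.2.2.1) h) ⟨j, ⟨hj'.1, h1⟩, h4⟩)
    rcases le_or_gt j D.t with h2 | h2
    · exact ((isBlock_etaSelf hq R ⟨j, h1, h2⟩).map_eq_zero_iff P Q).1
        (congrFun (congrArg (fun z => z.2.2.2.1) h) _)
    · exact ((isBlock_etaPair hq R ⟨j, h2, hj'.2⟩).map_eq_zero_iff P Q).1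
        (congrFun (congrArg (fun z => z.2.2.2.2) h) _)
  exact ⟨X_pow_sub_one_dvd_of_blocks D hq (fun j hj => (hf j hj).1) fun i hi => (hg i hi).1,
    X_pow_sub_one_dvd_of_blocks D hq (fun j hj => (hf j hj).2) fun i hi => (hg i hi).2⟩

theorem rho_injective : Function.Injective (rho hq R) := by
  rw [injective_iff_map_eq_zero]
  intro z hz
  obtain ⟨P, Q, rfl⟩ := exists_repr (ne_zero_of_coprime hq) z
  obtain ⟨hP, hQ⟩ := dvd_of_rho_eq_zero hq R hz
  rw [aeval_xx_eq_zero (ne_zero_of_coprime hq) hP, aeval_xx_eq_zero (ne_zero_of_coprime hq) hQ,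
    mul_zero, add_zero]

theorem rho_surjective : Function.Surjective (rho hq R) := by
  have : Finite {i : ℕ // i ∈ Set.Icc 1 (mu n) ∧ Nat.card F % 4 = 1} :=
    (Set.finite_Icc 1 (mu n)).subset fun i hi => hi.1
  have : Finite {i : ℕ // i ∈ Set.Icc 1 (mu n) ∧ Nat.card F % 4 = 3} :=
    (Set.finite_Icc 1 (mu n)).subset fun i hi => hi.1
  have h1 := IsSurjSum.pi (fun j => (isBlock_tauLin hq D j).surjective)
    (fun j => (isBlock_tauLin hq D j).map_poly_eq_zero)
    fun i j hij => isCoprime_fBlock D hq (mem_of_lin D hq i) (mem_of_lin D hq j)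
      (Subtype.coe_ne_coe.2 hij)
  have h2 := IsSurjSum.pi (fun j => (isBlock_tauSelf hq R j).surjective)
    (fun j => (isBlock_tauSelf hq R j).map_poly_eq_zero)
    fun i j hij => isCoprime_fBlock D hq (mem_of_self D i) (mem_of_self D j)
      (Subtype.coe_ne_coe.2 hij)
  have h3 := IsSurjSum.pi (fun j => (isBlock_tauPair hq R j).surjective)
    (fun j => (isBlock_tauPair hq R j).map_poly_eq_zero)
    fun i j hij => isCoprime_fBlock D hq (mem_of_pair D i) (mem_of_pair D j)
      (Subtype.coe_ne_coe.2 hij)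
  have h4 := IsSurjSum.pi (fun j => (isBlock_etaSplit hq R j).surjective)
    (fun j => (isBlock_etaSplit hq R j).map_poly_eq_zero)
    fun i j hij => isCoprime_gBlock D hq (mem_of_le_mu D hq i.2.1) (mem_of_le_mu D hq j.2.1)
      (Subtype.coe_ne_coe.2 hij)
  have h5 := IsSurjSum.pi (fun j => (isBlock_etaField hq D j).surjective)
    (fun j => (isBlock_etaField hq D j).map_poly_eq_zero)
    fun i j hij => isCoprime_gBlock D hq (mem_of_le_mu D hq i.2.1) (mem_of_le_mu D hq j.2.1)
      (Subtype.coe_ne_coe.2 hij)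
  have h6 := IsSurjSum.pi (fun j => (isBlock_etaSelf hq R j).surjective)
    (fun j => (isBlock_etaSelf hq R j).map_poly_eq_zero)
    fun i j hij => isCoprime_gBlock D hq (mem_of_self' D i) (mem_of_self' D j)
      (Subtype.coe_ne_coe.2 hij)
  have h7 := IsSurjSum.pi (fun j => (isBlock_etaPair hq R j).surjective)
    (fun j => (isBlock_etaPair hq R j).map_poly_eq_zero)
    fun i j hij => isCoprime_gBlock D hq (mem_of_pair' D i) (mem_of_pair' D j)
      (Subtype.coe_ne_coe.2 hij)
  refine ((h1.prod (h2.prod h3 ?_) ?_).prod (h4.prod (h5.prod (h6.prod h7 ?_) ?_) ?_) ?_).surjective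
  · rintro _ ⟨i, rfl⟩ _ ⟨j, rfl⟩
    exact isCoprime_fBlock D hq (mem_of_self D i) (mem_of_pair D j)
      (i.2.2.trans_lt j.2.1).ne
  · rintro _ ⟨i, rfl⟩ _ (⟨j, rfl⟩ | ⟨j, rfl⟩)
    · exact isCoprime_fBlock D hq (mem_of_lin D hq i) (mem_of_self D j)
        (i.2.2.trans_lt j.2.1).ne
    · exact isCoprime_fBlock D hq (mem_of_lin D hq i) (mem_of_pair D j)
        ((i.2.2.trans (delta_le D hq)).trans_lt j.2.1).ne
  · rintro _ ⟨i, rfl⟩ _ ⟨j, rfl⟩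
    exact isCoprime_gBlock D hq (mem_of_self' D i) (mem_of_pair' D j)
      (i.2.2.trans_lt j.2.1).ne
  · rintro _ ⟨i, rfl⟩ _ (⟨j, rfl⟩ | ⟨j, rfl⟩)
    · exact isCoprime_gBlock D hq (mem_of_le_mu D hq i.2.1) (mem_of_self' D j)
        (i.2.1.2.trans_lt j.2.1).ne
    · exact isCoprime_gBlock D hq (mem_of_le_mu D hq i.2.1) (mem_of_pair' D j)
        ((i.2.1.2.trans (mu_le D hq)).trans_lt j.2.1).ne
  · rintro _ ⟨i, rfl⟩ _ (⟨j, rfl⟩ | ⟨j, rfl⟩ | ⟨j, rfl⟩)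
    -- Both components belong to the same polynomial `x + 1`, but they cannot coexist: `q` would be
    -- both `1` and `3` modulo `4`.
    · have := i.2.2; have := j.2.2; omega
    · exact isCoprime_gBlock D hq (mem_of_le_mu D hq i.2.1) (mem_of_self' D j)
        (i.2.1.2.trans_lt j.2.1).ne
    · exact isCoprime_gBlock D hq (mem_of_le_mu D hq i.2.1) (mem_of_pair' D j)
        ((i.2.1.2.trans (mu_le D hq)).trans_lt j.2.1).ne
  · have hS : ∀ s ∈ (Set.range fun j : Set.Icc 1 (delta n) => blockPoly D.r D.f j) ∪
        ((Set.range fun j : Set.Ioc (delta n) D.r => blockPoly D.r D.f j) ∪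
          Set.range fun j : Set.Ioc D.r (D.r + D.s) => blockPoly D.r D.f j),
        ∃ j ∈ Finset.Icc 1 (D.r + D.s), s = blockPoly D.r D.f j := by
      rintro _ (⟨j, rfl⟩ | ⟨j, rfl⟩ | ⟨j, rfl⟩)
      exacts [⟨j, mem_of_lin D hq j, rfl⟩, ⟨j, mem_of_self D j, rfl⟩, ⟨j, mem_of_pair D j, rfl⟩]
    intro s hs t ht
    obtain ⟨j, hj, rfl⟩ := hS s hs
    rcases ht with ⟨i, rfl⟩ | ⟨i, rfl⟩ | ⟨i, rfl⟩ | ⟨i, rfl⟩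
    exacts [isCoprime_fBlock_gBlock D hq hj (mem_of_le_mu D hq i.2.1),
      isCoprime_fBlock_gBlock D hq hj (mem_of_le_mu D hq i.2.1),
      isCoprime_fBlock_gBlock D hq hj (mem_of_self' D i),
      isCoprime_fBlock_gBlock D hq hj (mem_of_pair' D i)]

end isBlock

/-! ### Left ideals of the blocks -/

section ideals

theorem leftIdeal_zero {A : Type*} [Ring A] : leftIdeal (0 : A) = {0} := by
  ext w
  simp [leftIdeal]

theorem leftIdeal_one {A : Type*} [Ring A] : leftIdeal (1 : A) = Set.univ := by
  ext w
  simp [leftIdeal]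

theorem leftIdeal_prod {F : Type*} [Field F] (a b : F) : leftIdeal (a, b) = linIdeal a b := by
  ext w
  constructor
  · rintro ⟨c, rfl⟩
    exact ⟨c.1, c.2, rfl⟩
  · rintro ⟨c, d, rfl⟩
    exact ⟨(c, d), rfl⟩

variable {K : Type*} [Field K] {M : Matrix (Fin 2) (Fin 2) K}

/-- A singular matrix with nonzero first row has second row a multiple `t` of it, so its left ideal
consists of all matrices whose rows are multiples of the first row. The signs arise because
`matIdeal x y` is spanned rowwise by `(y, -x)`. -/
theorem leftIdeal_eq_matIdeal_of_row_zero (hdet : M.det = 0) (h : M 0 0 ≠ 0 ∨ M 0 1 ≠ 0) :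
    leftIdeal M = matIdeal (M 0 1) (-M 0 0) := by
  obtain ⟨t, h10, h11⟩ : ∃ t, M 1 0 = t * M 0 0 ∧ M 1 1 = t * M 0 1 := by
    rw [Matrix.det_fin_two] at hdet
    rcases h with h | h
    · refine ⟨M 1 0 / M 0 0, by field_simp, ?_⟩
      field_simp
      linear_combination hdet
    · refine ⟨M 1 1 / M 0 1, ?_, by field_simp⟩
      field_simp
      linear_combination -hdet
  ext w
  constructor
  · rintro ⟨c, rfl⟩
    refine ⟨-(c 0 0 + c 0 1 * t), -(c 1 0 + c 1 1 * t), ?_⟩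
    ext i j
    fin_cases i <;> fin_cases j <;> simp [Matrix.mul_apply, h10, h11] <;> ring
  · rintro ⟨a, b, rfl⟩
    refine ⟨!![-a, 0; -b, 0], ?_⟩
    ext i j
    fin_cases i <;> fin_cases j <;> simp [Matrix.mul_apply]

theorem leftIdeal_eq_matIdeal_of_row_one (h0 : M 0 0 = 0) (h1 : M 0 1 = 0) :
    leftIdeal M = matIdeal (M 1 1) (-M 1 0) := by
  ext w
  constructor
  · rintro ⟨c, rfl⟩
    refine ⟨-c 0 1, -c 1 1, ?_⟩
    ext i j
    fin_cases i <;> fin_cases j <;> simp [Matrix.mul_apply, h0, h1]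
  · rintro ⟨a, b, rfl⟩
    refine ⟨!![0, -a; 0, -b], ?_⟩
    ext i j
    fin_cases i <;> fin_cases j <;> simp [Matrix.mul_apply]

/-- An invertible idempotent can be cancelled from `M M = M`, leaving `M = 1`. -/
theorem det_eq_zero_of_isIdempotentElem (hM : IsIdempotentElem M) (h1 : M ≠ 1) : M.det = 0 := by
  by_contra h
  have hu : IsUnit M := (Matrix.isUnit_iff_isUnit_det M).2 (isUnit_iff_ne_zero.2 h)
  exact h1 (hu.mul_left_cancel (by rw [mul_one]; exact hM))

end ideals

/-! ### Reading a block of the code off the products with the idempotents -/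

section cases

variable {F : Type*} [Field F] {n : ℕ} (hn : n ≠ 0) {lam : GA F n} (hlam : IsIdempotentElem lam)

include hn

theorem IsBlock.image_eq_zero {A : Type*} [Ring A] [Algebra F A] {τ : GA F n →ₐ[F] A} {p e : F[X]}
    (hτ : IsBlock τ p) (he1 : p ∣ e - 1) (he : X ^ (2 * n) - 1 ∣ p * e)
    (h : lam * aeval (xx F n) e = 0) : τ '' (Ideal.span {lam} : Ideal (GA F n)) = {0} := by
  rw [← zero_mul (aeval (xx F n) e), hτ.mul_aeval_eq_mul_aeval_iff hn he1 he, map_zero] at h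
  rw [hτ.image_span, h, leftIdeal_zero]

theorem IsBlock.image_eq_univ {A : Type*} [Ring A] [Algebra F A] {τ : GA F n →ₐ[F] A} {p e : F[X]}
    (hτ : IsBlock τ p) (he1 : p ∣ e - 1) (he : X ^ (2 * n) - 1 ∣ p * e)
    (h : lam * aeval (xx F n) e = aeval (xx F n) e) :
    τ '' (Ideal.span {lam} : Ideal (GA F n)) = Set.univ := by
  nth_rewrite 2 [← one_mul (aeval (xx F n) e)] at h
  rw [hτ.mul_aeval_eq_mul_aeval_iff hn he1 he, map_one] at h
  rw [hτ.image_span, h, leftIdeal_one]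

omit hn in
theorem IsBlock.image_eq_leftIdeal {A : Type*} [Ring A] [Algebra F A] {τ : GA F n →ₐ[F] A}
    {p e : F[X]} (hτ : IsBlock τ p) (he1 : p ∣ e - 1) :
    τ '' (Ideal.span {lam} : Ideal (GA F n)) = leftIdeal (τ (lam * aeval (xx F n) e)) := by
  rw [hτ.image_span, map_mul, hτ.map_aeval_eq_one he1, mul_one]

include hlam

/-- The four cases are the four idempotents of `F × F`. The element `w` is kept general so that `(1
± w) / 2` maps to `(1, 0)` and `(0, 1)` for both split types: `w = y` for `x^n - 1` and `w = -√-1 y`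
for `x^n + 1`. -/
theorem split_block_cases (h2 : (2 : F) ≠ 0) {τ : GA F n →ₐ[F] F × F} {p e : F[X]}
    (hτ : IsBlock τ p) (he1 : p ∣ e - 1) (he : X ^ (2 * n) - 1 ∣ p * e) {w : GA F n}
    (hw : τ w = (1, -1)) {φ : GA F n} (hφ : φ = lam * aeval (xx F n) e) :
    (φ = (2⁻¹ : F) • ((1 + w) * aeval (xx F n) e) ∨ φ = (2⁻¹ : F) • ((1 - w) * aeval (xx F n) e) ∨
        φ = 0 ∨ φ = aeval (xx F n) e) ∧
      (φ = (2⁻¹ : F) • ((1 + w) * aeval (xx F n) e) →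
        τ '' (Ideal.span {lam} : Ideal (GA F n)) = linIdeal 1 0) ∧
      (φ = (2⁻¹ : F) • ((1 - w) * aeval (xx F n) e) →
        τ '' (Ideal.span {lam} : Ideal (GA F n)) = linIdeal 0 1) ∧
      (φ = 0 → τ '' (Ideal.span {lam} : Ideal (GA F n)) = {0}) ∧
      (φ = aeval (xx F n) e → τ '' (Ideal.span {lam} : Ideal (GA F n)) = Set.univ) := by
  subst hφ
  have key := fun z : GA F n => hτ.mul_aeval_eq_mul_aeval_iff hn he1 he (z := lam) (w := z)
  have hp : τ ((2⁻¹ : F) • (1 + w)) = (1, 0) := by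
    rw [map_smul, map_add, map_one, hw]
    ext
    · simp; field_simp; ring
    · simp
  have hm : τ ((2⁻¹ : F) • (1 - w)) = (0, 1) := by
    rw [map_smul, map_sub, map_one, hw]
    ext
    · simp
    · simp; field_simp; ring
  rw [← smul_mul_assoc, ← smul_mul_assoc, key, key, hp, hm]
  refine ⟨?_, fun h => ?_, fun h => ?_, hτ.image_eq_zero hn he1 he, hτ.image_eq_univ hn he1 he⟩
  · have h0 := key 0
    have h1 := key 1
    rw [zero_mul, map_zero] at h0
    rw [one_mul, map_one] at h1
    rw [h0, h1]
    have hid : τ lam * τ lam = τ lam := by rw [← map_mul, hlam.eq]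
    clear h0 h1 key
    generalize τ lam = z at hid ⊢
    obtain ⟨a, b⟩ := z
    rw [Prod.mk_mul_mk, Prod.mk.injEq] at hid
    rcases IsIdempotentElem.iff_eq_zero_or_one.1 hid.1 with rfl | rfl <;>
      rcases IsIdempotentElem.iff_eq_zero_or_one.1 hid.2 with rfl | rfl <;> simp [Prod.ext_iff]
  · rw [hτ.image_span, h, leftIdeal_prod]
  · rw [hτ.image_span, h, leftIdeal_prod]

/-- If `φ` is neither `0` nor `e`, then `τ λ` is an idempotent other than `0` and `1`, hence of rank
one, and a nonzero row of it spans the ideal. -/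
theorem self_block_cases {K : Type*} [Field K] [Algebra F K]
    {τ : GA F n →ₐ[F] Matrix (Fin 2) (Fin 2) K} {p e : F[X]}
    (hτ : IsBlock τ p) (he1 : p ∣ e - 1) (he : X ^ (2 * n) - 1 ∣ p * e)
    {φ : GA F n} (hφ : φ = lam * aeval (xx F n) e) :
    (φ = 0 → τ '' (Ideal.span {lam} : Ideal (GA F n)) = {0}) ∧
      (φ = aeval (xx F n) e → τ '' (Ideal.span {lam} : Ideal (GA F n)) = Set.univ) ∧
      (φ ≠ 0 → φ ≠ aeval (xx F n) e → ∃ a b, (a, b) ≠ (0, 0) ∧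
        τ '' (Ideal.span {lam} : Ideal (GA F n)) = matIdeal a b) := by
  subst hφ
  refine ⟨hτ.image_eq_zero hn he1 he, hτ.image_eq_univ hn he1 he, fun h0 h1 => ?_⟩
  have key := fun z : GA F n => hτ.mul_aeval_eq_mul_aeval_iff hn he1 he (z := lam) (w := z)
  have k0 := key 0
  have k1 := key 1
  rw [zero_mul, map_zero] at k0
  rw [one_mul, map_one] at k1
  rw [Ne, k0] at h0
  rw [Ne, k1] at h1
  have hdet := det_eq_zero_of_isIdempotentElem (hlam.map τ) h1
  rw [hτ.image_span]
  by_cases h : τ lam 0 0 ≠ 0 ∨ τ lam 0 1 ≠ 0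
  · refine ⟨_, _, fun hab => ?_, leftIdeal_eq_matIdeal_of_row_zero hdet h⟩
    rw [Prod.mk.injEq, neg_eq_zero] at hab
    rcases h with h | h
    exacts [h hab.2, h hab.1]
  · push Not at h
    refine ⟨_, _, fun hab => h0 ?_, leftIdeal_eq_matIdeal_of_row_one h.1 h.2⟩
    rw [Prod.mk.injEq, neg_eq_zero] at hab
    ext i j
    fin_cases i <;> fin_cases j
    exacts [h.1, h.2, hab.2, hab.1]

theorem field_block_cases {A : Type*} [CommRing A] [IsDomain A] [Algebra F A]
    {τ : GA F n →ₐ[F] A} {p e : F[X]}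
    (hτ : IsBlock τ p) (he1 : p ∣ e - 1) (he : X ^ (2 * n) - 1 ∣ p * e)
    {φ : GA F n} (hφ : φ = lam * aeval (xx F n) e) :
    (φ = 0 ∨ φ = aeval (xx F n) e) ∧
      (φ = 0 → τ '' (Ideal.span {lam} : Ideal (GA F n)) = {0}) ∧
      (φ = aeval (xx F n) e → τ '' (Ideal.span {lam} : Ideal (GA F n)) = Set.univ) := by
  subst hφ
  refine ⟨?_, hτ.image_eq_zero hn he1 he, hτ.image_eq_univ hn he1 he⟩
  have key := fun z : GA F n => hτ.mul_aeval_eq_mul_aeval_iff hn he1 he (z := lam) (w := z)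
  have k0 := key 0
  have k1 := key 1
  rw [zero_mul, map_zero] at k0
  rw [one_mul, map_one] at k1
  rw [k0, k1]
  exact IsIdempotentElem.iff_eq_zero_or_one.1 (hlam.map τ)

/-- The images of `e_f` and `e_{f*}` are the diagonal matrix units, so the columns of `τ λ` are
`(u(γ), c v(γ))` and `(v'(γ⁻¹), u'(γ⁻¹))`. The cases follow its rows: use the first if it is
nonzero, otherwise the second. The constant `c = ±1` accounts for the sign that separates factors of
`x^n - 1` from those of `x^n + 1`. -/
theorem pair_block_cases {K : Type*} [Field K] [Algebra F K]
    {τ : GA F n →ₐ[F] Matrix (Fin 2) (Fin 2) K} {γ c : K}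
    (hx : τ (xx F n) = !![γ, 0; 0, γ⁻¹]) (hy : τ (yy F n) = !![0, 1; c, 0])
    {f : F[X]} (hτ : IsBlock τ (f * recip f))
    (hf : aeval γ f = 0) (hf' : aeval γ⁻¹ (recip f) = 0)
    (hsum : f * recip f ∣ idemPoly n f + idemPoly n (recip f) - 1)
    (he : X ^ (2 * n) - 1 ∣ f * idemPoly n f)
    (he' : X ^ (2 * n) - 1 ∣ recip f * idemPoly n (recip f))
    (h1 : f ∣ idemPoly n f - 1) (h2 : recip f ∣ idemPoly n f)
    (h1' : recip f ∣ idemPoly n (recip f) - 1) (h2' : f ∣ idemPoly n (recip f))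
    (huniq : ∀ P Q : F[X], aeval (xx F n) P + yy F n * aeval (xx F n) Q = 0 →
      aeval (xx F n) P = 0 ∧ aeval (xx F n) Q = 0)
    {u v u' v' : F[X]}
    (huv : lam * idem n f = aeval (xx F n) u + yy F n * aeval (xx F n) v)
    (huv' : lam * idem n (recip f) = aeval (xx F n) u' + yy F n * aeval (xx F n) v') :
    (FullCase n f u v u' v' → τ '' (Ideal.span {lam} : Ideal (GA F n)) = Set.univ) ∧
      (¬ FullCase n f u v u' v' → (aeval γ⁻¹ v', aeval γ u) ≠ (0, 0) →
        τ '' (Ideal.span {lam} : Ideal (GA F n)) = matIdeal (aeval γ⁻¹ v') (-aeval γ u)) ∧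
      (¬ FullCase n f u v u' v' →
        aeval γ⁻¹ v' = 0 → aeval γ u = 0 → (aeval γ⁻¹ u', aeval γ v) ≠ (0, 0) →
        τ '' (Ideal.span {lam} : Ideal (GA F n)) =
          matIdeal (aeval γ⁻¹ u') (-(c * aeval γ v))) ∧
      (aeval γ⁻¹ u' = 0 → aeval γ v = 0 → aeval γ⁻¹ v' = 0 → aeval γ u = 0 →
        τ '' (Ideal.span {lam} : Ideal (GA F n)) = {0}) := by
  have hval : ∀ {δ : K} {p a b : F[X]}, aeval δ p = 0 → p ∣ a - b → aeval δ a = aeval δ b := by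
    rintro δ p a b hp ⟨k, hk⟩
    have := congrArg (aeval δ) hk
    rw [map_mul, hp, zero_mul, map_sub] at this
    exact sub_eq_zero.1 this
  have e1 : τ (idem n f) = !![1, 0; 0, 0] := by
    rw [idem, ← aeval_algHom_apply, hx, aeval_diag, hval hf h1,
      hval hf' (b := 0) (by rwa [sub_zero]), map_one, map_zero]
  have e2 : τ (idem n (recip f)) = !![0, 0; 0, 1] := by
    rw [idem, ← aeval_algHom_apply, hx, aeval_diag, hval hf' h1',
      hval hf (b := 0) (by rwa [sub_zero]), map_one, map_zero]
  have t1 := congrArg τ huv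
  have t2 := congrArg τ huv'
  rw [map_mul, e1, map_add, map_mul, hy, ← aeval_algHom_apply, ← aeval_algHom_apply, hx,
    aeval_diag, aeval_diag] at t1
  rw [map_mul, e2, map_add, map_mul, hy, ← aeval_algHom_apply, ← aeval_algHom_apply, hx,
    aeval_diag, aeval_diag] at t2
  have m00 : τ lam 0 0 = aeval γ u := by
    simpa [Matrix.mul_apply] using congrFun (congrFun t1 0) 0
  have m10 : τ lam 1 0 = c * aeval γ v := by
    simpa [Matrix.mul_apply] using congrFun (congrFun t1 1) 0
  have m01 : τ lam 0 1 = aeval γ⁻¹ v' := by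
    simpa [Matrix.mul_apply] using congrFun (congrFun t2 0) 1
  have m11 : τ lam 1 1 = aeval γ⁻¹ u' := by
    simpa [Matrix.mul_apply] using congrFun (congrFun t2 1) 1
  -- If `τ λ = 1`, then `λ` fixes both idempotents, and uniqueness of the form `P(x) + y Q(x)`
  -- forces the full case. Outside it the idempotent `τ λ` is therefore singular.
  have hfull : ¬ FullCase n f u v u' v' → τ lam ≠ 1 := by
    intro hnf h
    apply hnf
    have key : ∀ g : F[X], X ^ (2 * n) - 1 ∣ f * recip f * idemPoly n g →
        lam * idem n g = idem n g := fun g hg => by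
      rw [← sub_eq_zero]
      nth_rewrite 2 [← one_mul (idem n g)]
      rw [← sub_mul]
      exact hτ.mul_aeval_eq_zero hn hg (by rw [map_sub, h, map_one, sub_self])
    have a1 := huv.symm.trans (key f (he.trans ⟨recip f, by ring⟩))
    have a2 := huv'.symm.trans (key (recip f) (he'.trans ⟨f, by ring⟩))
    have b1 := huniq (u - idemPoly n f) v (by
      rw [map_sub, ← idem, ← a1]; abel)
    have b2 := huniq (u' - idemPoly n (recip f)) v' (by
      rw [map_sub, ← idem, ← a2]; abel)
    rw [map_sub, sub_eq_zero] at b1 b2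
    exact ⟨b2.2, b1.2, b1.1, b2.1⟩
  refine ⟨fun h => ?_, fun h h0 => ?_, fun h h0 h0' _ => ?_, fun h3 h4 h5 h6 => ?_⟩
  · refine hτ.image_eq_univ hn hsum ?_ ?_
    · rw [mul_add]
      exact dvd_add (he.trans ⟨recip f, by ring⟩) (he'.trans ⟨f, by ring⟩)
    · obtain ⟨hv', hv, hu, hu'⟩ := h
      rw [map_add, mul_add, ← idem, ← idem, huv, huv', hv, hv', hu, hu', mul_zero, add_zero,
        add_zero]
  · rw [hτ.image_span, ← m00, ← m01]
    refine leftIdeal_eq_matIdeal_of_row_zero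
      (det_eq_zero_of_isIdempotentElem (hlam.map τ) (hfull h)) ?_
    rw [← m00, ← m01, Ne, Prod.mk.injEq] at h0
    tauto
  -- With the first row zero, the second row generates the ideal without any appeal to singularity.
  · rw [hτ.image_span, ← m10, ← m11]
    exact leftIdeal_eq_matIdeal_of_row_one (m00.trans h0') (m01.trans h0)
  · have h : τ lam = 0 := by
      ext i j
      fin_cases i <;> fin_cases j
      exacts [m00.trans h6, m01.trans h5, m10.trans (by rw [h4, mul_zero]; rfl), m11.trans h3]
    rw [hτ.image_span, h, leftIdeal_zero]

end cases

/-! ### The idempotent of a pair of reciprocal factors -/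

section pairIdem

variable {F : Type*} [Field F] {n : ℕ}

/-- Modulo each factor one of the two polynomials is `1` and the other `0`, so their sum serves as
the unit of the block of the pair. -/
theorem dvd_idemPoly_add_idemPoly_sub_one (h2n : (2 * n : F) ≠ 0) {f g : F[X]}
    (hf : 1 ≤ f.natDegree) (hg : 1 ≤ g.natDegree) (hco : IsCoprime f g)
    (hd : f * g ∣ X ^ (2 * n) - 1) : f * g ∣ idemPoly n f + idemPoly n g - 1 := by
  have hfd := dvd_of_mul_right_dvd hd
  have hgd := dvd_of_mul_left_dvd hd
  refine hco.mul_dvd ?_ ?_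
  · rw [add_sub_right_comm]
    exact dvd_add (dvd_idemPoly_sub_one h2n hf hfd) (dvd_idemPoly_of_isCoprime hg hgd hfd hco)
  · rw [add_sub_assoc]
    exact dvd_add (dvd_idemPoly_of_isCoprime hf hfd hgd hco.symm) (dvd_idemPoly_sub_one h2n hg hgd)

end pairIdem

/-! ### Decomposition of the code and the final assembly -/

section main

variable {F : Type*} [Field F] [Finite F] {n : ℕ} {D : Factorization F n}
  {E : Type*} [Field E] [Algebra F E]

theorem aeval_eq_zero_of_repr_eq_zero (hq : (4 * n).Coprime (Nat.card F)) (R : RootData D E)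
    (P Q : F[X]) (h : aeval (xx F n) P + yy F n * aeval (xx F n) Q = 0) :
    aeval (xx F n) P = 0 ∧ aeval (xx F n) Q = 0 := by
  obtain ⟨hP, hQ⟩ := dvd_of_rho_eq_zero hq R (by rw [h, map_zero])
  exact ⟨aeval_xx_eq_zero (ne_zero_of_coprime hq) hP, aeval_xx_eq_zero (ne_zero_of_coprime hq) hQ⟩

theorem two_mul_natCast_ne_zero (hq : (4 * n).Coprime (Nat.card F)) : (2 * n : F) ≠ 0 :=
  mul_ne_zero (two_ne_zero_of_coprime hq) (natCast_ne_zero_of_coprime hq)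

/-- For `q ≡ 3 (mod 4)` the element `-1` is not a square, so the quadratic `T² + 1` has no root and
is irreducible. -/
theorem isDomain_adjoinRoot (h : Nat.card F % 4 = 3) :
    IsDomain (AdjoinRoot (X ^ 2 + 1 : F[X])) := by
  have := Fintype.ofFinite F
  have hns : ¬ IsSquare (-1 : F) := by
    rw [FiniteField.isSquare_neg_one_iff, ← Nat.card_eq_fintype_card]
    exact fun h' => h' h
  have hdeg : (X ^ 2 + 1 : F[X]).natDegree = 2 := by compute_degree!
  have hirr : Irreducible (X ^ 2 + 1 : F[X]) := by
    refine irreducible_of_degree_le_three_of_not_isRoot (by rw [hdeg]; simp) fun c hc => ?_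
    refine hns ⟨c, ?_⟩
    simp only [IsRoot, eval_add, eval_pow, eval_X, eval_one] at hc
    linear_combination -hc
  exact AdjoinRoot.isDomain_of_prime hirr.prime

variable (hq : (4 * n).Coprime (Nat.card F)) (R : RootData D E)

/-- The image of a left ideal generated by one element is the direct sum of its blocks. -/
theorem rho_image_span (lam : GA F n) :
    rho hq R '' (Ideal.span {lam} : Ideal (GA F n)) = {z : ASum R × BSum R |
      (∀ j, z.1.1 j ∈ tauLin hq j '' (Ideal.span {lam} : Ideal (GA F n))) ∧
      (∀ j, z.1.2.1 j ∈ tauSelf hq R j '' (Ideal.span {lam} : Ideal (GA F n))) ∧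
      (∀ j, z.1.2.2 j ∈ tauPair hq R j '' (Ideal.span {lam} : Ideal (GA F n))) ∧
      (∀ i, z.2.1 i ∈ etaSplit hq R i '' (Ideal.span {lam} : Ideal (GA F n))) ∧
      (∀ i, z.2.2.1 i ∈ etaField hq i '' (Ideal.span {lam} : Ideal (GA F n))) ∧
      (∀ i, z.2.2.2.1 i ∈ etaSelf hq R i '' (Ideal.span {lam} : Ideal (GA F n))) ∧
      (∀ i, z.2.2.2.2 i ∈ etaPair hq R i '' (Ideal.span {lam} : Ideal (GA F n)))} := by
  ext z
  constructor
  · rintro ⟨c, hc, rfl⟩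
    exact ⟨fun j => ⟨c, hc, rfl⟩, fun j => ⟨c, hc, rfl⟩, fun j => ⟨c, hc, rfl⟩,
      fun j => ⟨c, hc, rfl⟩, fun j => ⟨c, hc, rfl⟩, fun j => ⟨c, hc, rfl⟩, fun j => ⟨c, hc, rfl⟩⟩
  · rintro ⟨h1, h2, h3, h4, h5, h6, h7⟩
    simp only [(isBlock_tauLin hq D _).image_span] at h1
    simp only [(isBlock_tauSelf hq R _).image_span] at h2
    simp only [(isBlock_tauPair hq R _).image_span] at h3
    simp only [(isBlock_etaSplit hq R _).image_span] at h4
    simp only [(isBlock_etaField hq D _).image_span] at h5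
    simp only [(isBlock_etaSelf hq R _).image_span] at h6
    simp only [(isBlock_etaPair hq R _).image_span] at h7
    choose d1 h1 using h1
    choose d2 h2 using h2
    choose d3 h3 using h3
    choose d4 h4 using h4
    choose d5 h5 using h5
    choose d6 h6 using h6
    choose d7 h7 using h7
    -- The left multipliers chosen in the separate blocks come from a single element of the group
    -- algebra, by surjectivity of `ρ`.
    obtain ⟨w, hw⟩ := rho_surjective hq R ((d1, d2, d3), (d4, d5, d6, d7))
    refine ⟨w * lam, Ideal.mem_span_singleton'.2 ⟨w, rfl⟩, ?_⟩
    rw [map_mul, hw]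
    refine Prod.ext (Prod.ext ?_ (Prod.ext ?_ ?_)) (Prod.ext ?_ (Prod.ext ?_ (Prod.ext ?_ ?_)))
    exacts [funext fun j => (h1 j).symm, funext fun j => (h2 j).symm, funext fun j => (h3 j).symm,
      funext fun j => (h4 j).symm, funext fun j => (h5 j).symm, funext fun j => (h6 j).symm,
      funext fun j => (h7 j).symm]

end main

end QuatCode

open QuatCode in
theorem theorem2p1 {F : Type*} [Field F] [Finite F] {E : Type*} [Field E] [Algebra F E] {n : ℕ}
    (hq : (4 * n).Coprime (Nat.card F))
    (D : QuatCode.Factorization F n) (R : QuatCode.RootData D E)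
    (lam : QuatCode.GA F n) (hlam : IsIdempotentElem lam)
    (Code : Ideal (QuatCode.GA F n)) (hCode : Code = Ideal.span {lam}) :
    -- `ρ` is an isomorphism, and `ρ(Code)` is the direct sum of its blocks
    (Function.Bijective (QuatCode.rho hq R) ∧
      QuatCode.rho hq R '' Code = {z : QuatCode.ASum R × QuatCode.BSum R |
        (∀ j, z.1.1 j ∈ QuatCode.tauLin hq j '' Code) ∧
        (∀ j, z.1.2.1 j ∈ QuatCode.tauSelf hq R j '' Code) ∧
        (∀ j, z.1.2.2 j ∈ QuatCode.tauPair hq R j '' Code) ∧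
        (∀ i, z.2.1 i ∈ QuatCode.etaSplit hq R i '' Code) ∧
        (∀ i, z.2.2.1 i ∈ QuatCode.etaField hq i '' Code) ∧
        (∀ i, z.2.2.2.1 i ∈ QuatCode.etaSelf hq R i '' Code) ∧
        (∀ i, z.2.2.2.2 i ∈ QuatCode.etaPair hq R i '' Code)}) ∧
    -- the products `φ_j`, `φ̃_j`, `ψ_i`, `ψ̃_i` determine all blocks
    ((∀ j, QuatCode.tauLin hq j '' Code =
        QuatCode.leftIdeal (QuatCode.tauLin hq j (lam * QuatCode.idem n (D.f j)))) ∧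
      (∀ j, QuatCode.tauSelf hq R j '' Code =
        QuatCode.leftIdeal (QuatCode.tauSelf hq R j (lam * QuatCode.idem n (D.f j)))) ∧
      (∀ j, QuatCode.tauPair hq R j '' Code =
        QuatCode.leftIdeal (QuatCode.tauPair hq R j (lam * QuatCode.idem n (D.f j) +
          lam * QuatCode.idem n (QuatCode.recip (D.f j))))) ∧
      (∀ i, QuatCode.etaSplit hq R i '' Code =
        QuatCode.leftIdeal (QuatCode.etaSplit hq R i (lam * QuatCode.idem n (D.g i)))) ∧
      (∀ i, QuatCode.etaField hq i '' Code =
        QuatCode.leftIdeal (QuatCode.etaField hq i (lam * QuatCode.idem n (D.g i)))) ∧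
      (∀ i, QuatCode.etaSelf hq R i '' Code =
        QuatCode.leftIdeal (QuatCode.etaSelf hq R i (lam * QuatCode.idem n (D.g i)))) ∧
      (∀ i, QuatCode.etaPair hq R i '' Code =
        QuatCode.leftIdeal (QuatCode.etaPair hq R i (lam * QuatCode.idem n (D.g i) +
          lam * QuatCode.idem n (QuatCode.recip (D.g i)))))) ∧
    -- (i) `1 ≤ j ≤ δ(n)`
    (∀ (j : Set.Icc 1 (QuatCode.delta n)) (φ e : QuatCode.GA F n),
      e = QuatCode.idem n (D.f j) → φ = lam * e →
      (φ = (2⁻¹ : F) • ((1 + QuatCode.yy F n) * e) ∨ φ = (2⁻¹ : F) • ((1 - QuatCode.yy F n) * e) ∨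
        φ = 0 ∨ φ = e) ∧
      (φ = (2⁻¹ : F) • ((1 + QuatCode.yy F n) * e) →
        QuatCode.tauLin hq j '' Code = QuatCode.linIdeal 1 0) ∧
      (φ = (2⁻¹ : F) • ((1 - QuatCode.yy F n) * e) →
        QuatCode.tauLin hq j '' Code = QuatCode.linIdeal 0 1) ∧
      (φ = 0 → QuatCode.tauLin hq j '' Code = {0}) ∧
      (φ = e → QuatCode.tauLin hq j '' Code = Set.univ)) ∧
    -- (ii) `δ(n) < j ≤ r`
    (∀ (j : Set.Ioc (QuatCode.delta n) D.r) (φ e : QuatCode.GA F n),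
      e = QuatCode.idem n (D.f j) → φ = lam * e →
      (φ = 0 → QuatCode.tauSelf hq R j '' Code = {0}) ∧
      (φ = e → QuatCode.tauSelf hq R j '' Code = Set.univ) ∧
      (φ ≠ 0 → φ ≠ e → ∃ a b, (a, b) ≠ (0, 0) ∧
        QuatCode.tauSelf hq R j '' Code = QuatCode.matIdeal a b)) ∧
    -- (iii) `r < j ≤ r + s`
    (∀ (j : Set.Ioc D.r (D.r + D.s)) (u v u' v' : F[X]),
      lam * QuatCode.idem n (D.f j) =
        aeval (QuatCode.xx F n) u + QuatCode.yy F n * aeval (QuatCode.xx F n) v →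
      lam * QuatCode.idem n (QuatCode.recip (D.f j)) =
        aeval (QuatCode.xx F n) u' + QuatCode.yy F n * aeval (QuatCode.xx F n) v' →
      ∀ α : F⟮R.α j⟯, α = AdjoinSimple.gen F (R.α j) →
      (QuatCode.FullCase n (D.f j) u v u' v' → QuatCode.tauPair hq R j '' Code = Set.univ) ∧
      (¬ QuatCode.FullCase n (D.f j) u v u' v' →
        (aeval α⁻¹ v', aeval α u) ≠ (0, 0) →
        QuatCode.tauPair hq R j '' Code = QuatCode.matIdeal (aeval α⁻¹ v') (-aeval α u)) ∧
      (¬ QuatCode.FullCase n (D.f j) u v u' v' →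
        aeval α⁻¹ v' = 0 → aeval α u = 0 → (aeval α⁻¹ u', aeval α v) ≠ (0, 0) →
        QuatCode.tauPair hq R j '' Code = QuatCode.matIdeal (aeval α⁻¹ u') (-aeval α v)) ∧
      (aeval α⁻¹ u' = 0 → aeval α v = 0 → aeval α⁻¹ v' = 0 → aeval α u = 0 →
        QuatCode.tauPair hq R j '' Code = {0})) ∧
    -- (iv) `1 ≤ i ≤ μ(n)`, `q ≡ 1 (mod 4)`
    (∀ (i : {i : ℕ // i ∈ Set.Icc 1 (QuatCode.mu n) ∧ Nat.card F % 4 = 1}) (ψ e : QuatCode.GA F n),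
      e = QuatCode.idem n (D.g i) → ψ = lam * e →
      (ψ = (2⁻¹ : F) • ((1 - R.ι • QuatCode.yy F n) * e) ∨
        ψ = (2⁻¹ : F) • ((1 + R.ι • QuatCode.yy F n) * e) ∨ ψ = 0 ∨ ψ = e) ∧
      (ψ = (2⁻¹ : F) • ((1 - R.ι • QuatCode.yy F n) * e) →
        QuatCode.etaSplit hq R i '' Code = QuatCode.linIdeal 1 0) ∧
      (ψ = (2⁻¹ : F) • ((1 + R.ι • QuatCode.yy F n) * e) →
        QuatCode.etaSplit hq R i '' Code = QuatCode.linIdeal 0 1) ∧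
      (ψ = 0 → QuatCode.etaSplit hq R i '' Code = {0}) ∧
      (ψ = e → QuatCode.etaSplit hq R i '' Code = Set.univ)) ∧
    -- (iv) `1 ≤ i ≤ μ(n)`, `q ≡ 3 (mod 4)`
    (∀ (i : {i : ℕ // i ∈ Set.Icc 1 (QuatCode.mu n) ∧ Nat.card F % 4 = 3}) (ψ e : QuatCode.GA F n),
      e = QuatCode.idem n (D.g i) → ψ = lam * e →
      (ψ = 0 ∨ ψ = e) ∧
      (ψ = 0 → QuatCode.etaField hq i '' Code = {0}) ∧
      (ψ = e → QuatCode.etaField hq i '' Code = Set.univ)) ∧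
    -- (v) `μ(n) < i ≤ t`
    (∀ (i : Set.Ioc (QuatCode.mu n) D.t) (ψ e : QuatCode.GA F n),
      e = QuatCode.idem n (D.g i) → ψ = lam * e →
      (ψ = 0 → QuatCode.etaSelf hq R i '' Code = {0}) ∧
      (ψ = e → QuatCode.etaSelf hq R i '' Code = Set.univ) ∧
      (ψ ≠ 0 → ψ ≠ e → ∃ a b, (a, b) ≠ (0, 0) ∧
        QuatCode.etaSelf hq R i '' Code = QuatCode.matIdeal a b)) ∧
    -- (vi) `t < i ≤ t + k`
    (∀ (i : Set.Ioc D.t (D.t + D.k)) (u v u' v' : F[X]),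
      lam * QuatCode.idem n (D.g i) =
        aeval (QuatCode.xx F n) u + QuatCode.yy F n * aeval (QuatCode.xx F n) v →
      lam * QuatCode.idem n (QuatCode.recip (D.g i)) =
        aeval (QuatCode.xx F n) u' + QuatCode.yy F n * aeval (QuatCode.xx F n) v' →
      ∀ β : F⟮R.β i⟯, β = AdjoinSimple.gen F (R.β i) →
      (QuatCode.FullCase n (D.g i) u v u' v' → QuatCode.etaPair hq R i '' Code = Set.univ) ∧
      (¬ QuatCode.FullCase n (D.g i) u v u' v' →
        (aeval β⁻¹ v', aeval β u) ≠ (0, 0) →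
        QuatCode.etaPair hq R i '' Code = QuatCode.matIdeal (aeval β⁻¹ v') (-aeval β u)) ∧
      (¬ QuatCode.FullCase n (D.g i) u v u' v' →
        aeval β⁻¹ v' = 0 → aeval β u = 0 → (aeval β⁻¹ u', aeval β v) ≠ (0, 0) →
        QuatCode.etaPair hq R i '' Code = QuatCode.matIdeal (aeval β⁻¹ u') (aeval β v)) ∧
      (aeval β⁻¹ u' = 0 → aeval β v = 0 → aeval β⁻¹ v' = 0 → aeval β u = 0 →
        QuatCode.etaPair hq R i '' Code = {0})) := by
  subst hCode
  have hn := ne_zero_of_coprime hq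
  have h2n := two_mul_natCast_ne_zero hq
  have h2 := two_ne_zero_of_coprime hq
  have huniq := aeval_eq_zero_of_repr_eq_zero hq R
  have fdeg : ∀ {j}, j ∈ Finset.Icc 1 (D.r + D.s) → 1 ≤ (D.f j).natDegree := fun hj =>
    (D.f_irreducible _ hj).natDegree_pos
  have gdeg : ∀ {j}, j ∈ Finset.Icc 1 (D.t + D.k) → 1 ≤ (D.g j).natDegree := fun hj =>
    (D.g_irreducible _ hj).natDegree_pos
  have fself : ∀ j, j ∈ Finset.Icc 1 (D.r + D.s) → j ≤ D.r →
      blockPoly D.r D.f j ∣ idemPoly n (D.f j) - 1 ∧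
      X ^ (2 * n) - 1 ∣ blockPoly D.r D.f j * idemPoly n (D.f j) := fun j hj hjr => by
    have hd := fBlock_dvd_two_mul D hj
    rw [blockPoly, if_pos hjr] at hd ⊢
    exact ⟨dvd_idemPoly_sub_one h2n (fdeg hj) hd, dvd_mul_idemPoly (fdeg hj) hd⟩
  have gself : ∀ j, j ∈ Finset.Icc 1 (D.t + D.k) → j ≤ D.t →
      blockPoly D.t D.g j ∣ idemPoly n (D.g j) - 1 ∧
      X ^ (2 * n) - 1 ∣ blockPoly D.t D.g j * idemPoly n (D.g j) := fun j hj hjr => by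
    have hd := gBlock_dvd_two_mul D hj
    rw [blockPoly, if_pos hjr] at hd ⊢
    exact ⟨dvd_idemPoly_sub_one h2n (gdeg hj) hd, dvd_mul_idemPoly (gdeg hj) hd⟩
  -- Positive degree of `f*` is what the statements about `e_{f*}` require; it follows from
  -- irreducibility.
  have frecip : ∀ j : Set.Ioc D.r (D.r + D.s), 1 ≤ (recip (D.f j)).natDegree := fun j =>
    (recip_irreducible (f_coeff_zero_ne_zero D hq (mem_of_pair D j)) (D.f_monic j (mem_of_pair D j))
      (D.f_irreducible j (mem_of_pair D j)) (α_ne_zero hq R (mem_of_pair D j))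
      (R.α_root j (mem_of_pair D j))).natDegree_pos
  have grecip : ∀ j : Set.Ioc D.t (D.t + D.k), 1 ≤ (recip (D.g j)).natDegree := fun j =>
    (recip_irreducible (g_coeff_zero_ne_zero D hq (mem_of_pair' D j))
      (D.g_monic j (mem_of_pair' D j))
      (D.g_irreducible j (mem_of_pair' D j)) (β_ne_zero hq R (mem_of_pair' D j))
      (R.β_root j (mem_of_pair' D j))).natDegree_pos
  have fpair : ∀ j : Set.Ioc D.r (D.r + D.s),
      blockPoly D.r D.f j = D.f j * recip (D.f j) := fun j => if_neg (not_le.2 j.2.1)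
  have gpair : ∀ i : Set.Ioc D.t (D.t + D.k),
      blockPoly D.t D.g i = D.g i * recip (D.g i) := fun i => if_neg (not_le.2 i.2.1)
  have fdvd : ∀ j : Set.Ioc D.r (D.r + D.s), D.f j * recip (D.f j) ∣ X ^ (2 * n) - 1 := fun j =>
    fpair j ▸ fBlock_dvd_two_mul D (mem_of_pair D j)
  have gdvd : ∀ i : Set.Ioc D.t (D.t + D.k), D.g i * recip (D.g i) ∣ X ^ (2 * n) - 1 := fun i =>
    gpair i ▸ gBlock_dvd_two_mul D (mem_of_pair' D i)
  have fsum : ∀ j : Set.Ioc D.r (D.r + D.s),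
      D.f j * recip (D.f j) ∣ idemPoly n (D.f j) + idemPoly n (recip (D.f j)) - 1 := fun j =>
    dvd_idemPoly_add_idemPoly_sub_one h2n (fdeg (mem_of_pair D j)) (frecip j)
      (isCoprime_f_recip D hq j) (fdvd j)
  have gsum : ∀ i : Set.Ioc D.t (D.t + D.k),
      D.g i * recip (D.g i) ∣ idemPoly n (D.g i) + idemPoly n (recip (D.g i)) - 1 := fun i =>
    dvd_idemPoly_add_idemPoly_sub_one h2n (gdeg (mem_of_pair' D i)) (grecip i)
      (isCoprime_g_recip D hq i) (gdvd i)
  refine ⟨⟨⟨rho_injective hq R, rho_surjective hq R⟩, rho_image_span hq R lam⟩,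
    ⟨fun j => ?_, fun j => ?_, fun j => ?_, fun i => ?_, fun i => ?_, fun i => ?_, fun i => ?_⟩,
    ?_, ?_, ?_, ?_, ?_, ?_, ?_⟩
  · exact (isBlock_tauLin hq D j).image_eq_leftIdeal
      (fself j (mem_of_lin D hq j) (j.2.2.trans (delta_le D hq))).1
  · exact (isBlock_tauSelf hq R j).image_eq_leftIdeal (fself j (mem_of_self D j) j.2.2).1
  · rw [← mul_add, idem, idem, ← map_add]
    exact (isBlock_tauPair hq R j).image_eq_leftIdeal (by rw [fpair]; exact fsum j)
  · exact (isBlock_etaSplit hq R i).image_eq_leftIdeal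
      (gself i (mem_of_le_mu D hq i.2.1) (i.2.1.2.trans (mu_le D hq))).1
  · exact (isBlock_etaField hq D i).image_eq_leftIdeal
      (gself i (mem_of_le_mu D hq i.2.1) (i.2.1.2.trans (mu_le D hq))).1
  · exact (isBlock_etaSelf hq R i).image_eq_leftIdeal (gself i (mem_of_self' D i) i.2.2).1
  · rw [← mul_add, idem, idem, ← map_add]
    exact (isBlock_etaPair hq R i).image_eq_leftIdeal (by rw [gpair]; exact gsum i)
  · rintro j φ e rfl hφ
    obtain ⟨h1, h1'⟩ := fself j (mem_of_lin D hq j) (j.2.2.trans (delta_le D hq))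
    exact split_block_cases hn hlam h2 (isBlock_tauLin hq D j) h1 h1' (tauLin_yy hq j) hφ
  · rintro j φ e rfl hφ
    obtain ⟨h1, h1'⟩ := fself j (mem_of_self D j) j.2.2
    exact self_block_cases hn hlam (isBlock_tauSelf hq R j) h1 h1' hφ
  · rintro j u v u' v' huv huv' α rfl
    have hm := mem_of_pair D j
    have hf := aeval_gen_eq_zero (R.α_root j hm)
    have hd := fdvd j
    have hd1 := dvd_of_mul_right_dvd hd
    have hd2 := dvd_of_mul_left_dvd hd
    have hco := isCoprime_f_recip D hq j
    have := pair_block_cases hn hlam (tauPair_xx hq R j) (tauPair_yy hq R j)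
      (fpair j ▸ isBlock_tauPair hq R j) hf
      ((aeval_inv_recip (f_coeff_zero_ne_zero D hq hm) (gen_ne_zero (α_ne_zero hq R hm))).2 hf)
      (fsum j) (dvd_mul_idemPoly (fdeg hm) hd1) (dvd_mul_idemPoly (frecip j) hd2)
      (dvd_idemPoly_sub_one h2n (fdeg hm) hd1)
      (dvd_idemPoly_of_isCoprime (fdeg hm) hd1 hd2 hco.symm)
      (dvd_idemPoly_sub_one h2n (frecip j) hd2)
      (dvd_idemPoly_of_isCoprime (frecip j) hd2 hd1 hco) huniq huv huv'
    rwa [one_mul] at this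
  · rintro i ψ e rfl hψ
    obtain ⟨h1, h1'⟩ := gself i (mem_of_le_mu D hq i.2.1) (i.2.1.2.trans (mu_le D hq))
    -- As `y ↦ (√-1, -√-1)`, multiplying by `-√-1` normalizes the image to `(1, -1)`. This is why
    -- the minus sign goes with `linIdeal 1 0` here, opposite to the factors of `x^n - 1`.
    have hw : etaSplit hq R i (-(R.ι • yy F n)) = (1, -1) := by
      have hι := R.ι_sq i.2.2
      rw [map_neg, map_smul, etaSplit_yy]
      ext
      · simp; linear_combination -hι
      · simp; linear_combination hι
    have := split_block_cases hn hlam h2 (isBlock_etaSplit hq R i) h1 h1' hw hψ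
    rwa [← sub_eq_add_neg, sub_neg_eq_add] at this
  · rintro i ψ e rfl hψ
    obtain ⟨h1, h1'⟩ := gself i (mem_of_le_mu D hq i.2.1) (i.2.1.2.trans (mu_le D hq))
    have := isDomain_adjoinRoot i.2.2
    exact field_block_cases hn hlam (isBlock_etaField hq D i) h1 h1' hψ
  · rintro i ψ e rfl hψ
    obtain ⟨h1, h1'⟩ := gself i (mem_of_self' D i) i.2.2
    exact self_block_cases hn hlam (isBlock_etaSelf hq R i) h1 h1' hψ
  · rintro i u v u' v' huv huv' β rfl
    have hm := mem_of_pair' D i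
    have hf := aeval_gen_eq_zero (R.β_root i hm)
    have hd := gdvd i
    have hd1 := dvd_of_mul_right_dvd hd
    have hd2 := dvd_of_mul_left_dvd hd
    have hco := isCoprime_g_recip D hq i
    have := pair_block_cases hn hlam (etaPair_xx hq R i) (etaPair_yy hq R i)
      (gpair i ▸ isBlock_etaPair hq R i) hf
      ((aeval_inv_recip (g_coeff_zero_ne_zero D hq hm) (gen_ne_zero (β_ne_zero hq R hm))).2 hf)
      (gsum i) (dvd_mul_idemPoly (gdeg hm) hd1) (dvd_mul_idemPoly (grecip i) hd2)
      (dvd_idemPoly_sub_one h2n (gdeg hm) hd1)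
      (dvd_idemPoly_of_isCoprime (gdeg hm) hd1 hd2 hco.symm)
      (dvd_idemPoly_sub_one h2n (grecip i) hd2)
      (dvd_idemPoly_of_isCoprime (grecip i) hd2 hd1 hco) huniq huv huv'
    -- Here `c = -1`, so the second generator becomes `+v(β)`.
    rwa [neg_one_mul, neg_neg] at this
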